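/- Let $\sigma_\epsilon,\sigma_\theta>0$, $\theta\in\mathbb R$, $\sigma=\sqrt{\sigma_\epsilon^2+\sigma_\theta^2}$, $\tau=\sigma_\theta^2/\sigma^2$, $\sigma_v=\sigma_\epsilon\sigma_\theta/\sigma$, $\mu_x=\tau x+(1-\tau)\theta$, and let $\Phi,\phi$ be the standard normal distribution function and density. A product of unknown quality $v\sim N(\theta,\sigma_\theta^2)$ is sold at the price $p$ to a unit mass of consumers with private valuations $v_i=v+\epsilon_i$, $\epsilon_i\sim N(0,\sigma_\epsilon^2)$, so that a consumer with valuation $x$ believes $v\sim N(\mu_x,\sigma_v^2)$; write $\mathbb E_{v|x}$ for the expectation under this belief. The price $p$ maximizes $q\mapsto q\,\Phi(\frac{\theta-q}{\sigma})$. Put $B=\sqrt{2\pi}\,\sigma_\epsilon\sigma/\sigma_\theta$ and $r_M=\min(p,B)$. (1) Let $r:[0,1]\to[0,p]$ be a (measurable) reward program, paid as a function of the sales volume, with $\sup r-\inf r\le B$. If the others buy exactly when their valuation exceeds $c$, the sales volume is $\Phi(\frac{v-c}{\sigma_\epsilon})$, and the expected payoff of buying, $x-p+\mathbb E_{v|x}[r(\Phi(\frac{v-c}{\sigma_\epsilon}))]$,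 is strictly increasing in the valuation $x$. Buying exactly at valuations above $c$ is an equilibrium of the consumers' game if and only if $c+\mathbb E_{v|c}[r(\Phi(\frac{v-c}{\sigma_\epsilon}))]=p$, and such an equilibrium exists. (2) Consider the problem of maximizing the expected profit $\mathbb E_v[(p-\hat r(v))\Phi(\frac{v-c}{\sigma_\epsilon})]$, $v\sim N(\theta,\sigma_\theta^2)$, over measurable $\hat r:\mathbb R\to[0,p]$ and $c\in\mathbb R$ subject to $\sup\hat r-\inf\hat r\le B$ and $c+\mathbb E_{v|c}[\hat r(v)]=p$. It has a solution, and for every solution $(\hat r,c)$ there is $v_c\in\mathbb R$ such that $\hat r(v)=r_M\mathbf 1\{v\le v_c\}$ for almost every $v$ (and this step function with the cutoff $c$ is itself optimal), where $(c,v_c)$ solves $$p=c+r_M\,\Phi\Big(\frac{v_c-\mu_c}{\sigma_v}\Big),\qquad \frac{\Phi(\frac{v_c-c}{\sigma_\epsilon})}{\frac1{\sigma_\epsilon}\phi(\frac{v_c-c}{\sigma_\epsilon})}=\frac{c}{1-\tau r_M\frac1{\sigma_v}\phi(\frac{v_c-\mu_c}{\sigma_v})}.\qquad(*)$$ Conversely,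 a solution $(c,v_c)$ of $(*)$ whose step program has the highest expected profit among all solutions of $(*)$ is optimal. (3) Under such an optimal step program the equilibrium cutoff is unique: when the reward $r_M$ is paid exactly if the sales volume is at most $\Phi(\frac{v_c-c}{\sigma_\epsilon})$, buying exactly at valuations above $x$ is an equilibrium of the consumers' game if and only if $x=c$; and $c$ is the only solution $x$ of $x+\mathbb E_{v|x}[r_M\mathbf 1\{v\le v_c\}]=p$. -/

import Mathlib

open MeasureTheory ProbabilityTheory Set

namespace RewardProgram

/-- The standard normal distribution function. -/
noncomputable def Phi (x : ℝ) : ℝ := cdf (gaussianReal 0 1) x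

/-- The standard normal density. -/
noncomputable def phi (x : ℝ) : ℝ := gaussianPDFReal 0 1 x

/-- The normal law with mean `m` and standard deviation `s`. -/
noncomputable def normalLaw (m s : ℝ) : Measure ℝ := gaussianReal m ⟨s ^ 2, sq_nonneg s⟩

/-- The market: quality `v ∼ N(θ, σθ²)`, valuations `v_i = v + ε_i` with `ε_i ∼ N(0, σε²)`. -/
structure Market where
  /-- prior mean of the quality -/
  θ : ℝ
  /-- standard deviation of the quality -/
  σθ : ℝ
  /-- standard deviation of the idiosyncratic tastes -/
  σε : ℝ
  σθ_pos : 0 < σθ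
  σε_pos : 0 < σε

namespace Market

variable (M : Market)

/-- Standard deviation of the total uncertainty in a valuation. -/
noncomputable def σ : ℝ := √(M.σε ^ 2 + M.σθ ^ 2)

/-- Weight of the own valuation in the posterior mean of the quality. -/
noncomputable def τ : ℝ := M.σθ ^ 2 / (M.σε ^ 2 + M.σθ ^ 2)

/-- Posterior standard deviation of the quality. -/
noncomputable def σv : ℝ := M.σε * M.σθ / √(M.σε ^ 2 + M.σθ ^ 2)

/-- Posterior mean of the quality given the valuation `x`. -/
noncomputable def μ (x : ℝ) : ℝ := M.τ * x + (1 - M.τ) * M.θ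

/-- Belief about the quality held by a consumer with valuation `x`. -/
noncomputable def posterior (x : ℝ) : Measure ℝ := normalLaw (M.μ x) M.σv

/-- Sales volume at quality `v` if exactly the consumers with valuation above `c` buy. -/
noncomputable def sales (c v : ℝ) : ℝ := Phi ((v - c) / M.σε)

/-- `p` maximizes the ex-ante expected profit without rewards (at zero marginal cost). -/
def IsOptimalPrice (p : ℝ) : Prop :=
  ∀ q : ℝ, q * Phi ((M.θ - q) / M.σ) ≤ p * Phi ((M.θ - p) / M.σ)

/-- The bound imposed on the spread of the rewards. -/
noncomputable def spreadBound : ℝ := √(2 * Real.pi) * (M.σε * M.σ / M.σθ)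

/-- Expected profit of the firm when it pays `rhat v` to every buyer at quality `v`, and the
consumers with valuation above `c` buy. -/
noncomputable def profit (p : ℝ) (rhat : ℝ → ℝ) (c : ℝ) : ℝ :=
  ∫ v, (p - rhat v) * M.sales c v ∂(normalLaw M.θ M.σθ)

/-- Reward expected by a consumer with valuation `x`. -/
noncomputable def expectedReward (rhat : ℝ → ℝ) (x : ℝ) : ℝ := ∫ v, rhat v ∂(M.posterior x)

/-- The feasible pairs of the firm's problem: a measurable program with values in `[0, p]`, with
`r_max - r_min` at most the bound, and a cutoff that satisfies the indifference equation. -/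
structure Feasible (p : ℝ) (rhat : ℝ → ℝ) (c : ℝ) : Prop where
  measurable : Measurable rhat
  mem_Icc : ∀ v, rhat v ∈ Icc 0 p
  spread : ∀ v w, rhat v - rhat w ≤ M.spreadBound
  indifference : c + M.expectedReward rhat c = p

/-- The pair `(rhat, c)` solves the firm's problem. -/
def IsOptimal (p : ℝ) (rhat : ℝ → ℝ) (c : ℝ) : Prop :=
  M.Feasible p rhat c ∧ ∀ s d, M.Feasible p s d → M.profit p s d ≤ M.profit p rhat c

/-- A program `r` that pays a reward as a function of the sales volume in `[0, 1]`, and that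
satisfies the spread constraint. -/
structure IsSpreadProgram (p : ℝ) (r : ℝ → ℝ) : Prop where
  measurable : Measurable r
  mem_Icc : ∀ a ∈ Icc (0 : ℝ) 1, r a ∈ Icc 0 p
  spread : ∀ a ∈ Icc (0 : ℝ) 1, ∀ b ∈ Icc (0 : ℝ) 1, r a - r b ≤ M.spreadBound

/-- Expected payoff of buying for valuation `x`, under the sales-based program `r`, if the others
buy exactly at valuations above `c`. -/
noncomputable def payoff (p : ℝ) (r : ℝ → ℝ) (c x : ℝ) : ℝ :=
  x - p + M.expectedReward (fun v => r (M.sales c v)) x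

/-- Buying exactly at valuations above `c` is a symmetric Bayes-Nash equilibrium of the consumers'
subgame: it is the best reply `1{payoff > 0}` to itself. -/
def IsEquilibrium (p : ℝ) (r : ℝ → ℝ) (c : ℝ) : Prop :=
  ∀ x, c < x ↔ 0 < M.payoff p r c x

/-- The size of the optimal reward. -/
noncomputable def rM (p : ℝ) : ℝ := min p M.spreadBound

/-- The single-step program `v ↦ r_M 1{v ≤ vc}`. -/
noncomputable def step (p vc : ℝ) : ℝ → ℝ := (Iic vc).indicator fun _ => M.rM p

/-- The single-step program as a function of the sales volume, for the cutoff `c`: it pays `r_M` as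
long as the sales volume does not exceed the one at quality `vc`. -/
noncomputable def salesStep (p c vc : ℝ) : ℝ → ℝ := (Iic (M.sales c vc)).indicator fun _ => M.rM p

/-- The indifference equation and the first-order equation for `(c, vc)`. -/
def SolvesSystem (p c vc : ℝ) : Prop :=
  p = c + M.rM p * Phi ((vc - M.μ c) / M.σv) ∧
  Phi ((vc - c) / M.σε) / (phi ((vc - c) / M.σε) / M.σε)
    = c / (1 - M.τ * M.rM p * (phi ((vc - M.μ c) / M.σv) / M.σv))

end Market

end RewardProgram

open Filter Topology

namespace RewardProgram

/-! ### The standard normal distribution: derivatives, symmetry, numerical bounds, tails. -/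

section Normal

/-! Part (1) rests on the total variation distance of two normal laws with equal variance: shifting
the mean by h changes the expectation of a function of oscillation at most B by less than B h φ(0)/s
(`integral_sub_integral_normalLaw_lt`). The spread bound makes this exactly the change in the
valuation, so x + E[r | x] is strictly increasing and continuous; existence then follows from the
intermediate value theorem.

For part (2), put N = Φ/φ. Bayes' rule writes prior density times sales at quality u as a positive
constant, depending on c, times the posterior density of consumer c times N((u-c)/σε)
(`normalDensity_mul_sales`). Since N increases, rewards that keep c indifferent are cheapest at low
quality. As in the Neyman-Pearson lemma, a program with values in [a, a+R], R = r_M, is then beaten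
by a step (`profit_le_stepProfit`), apart from constant programs, which earn at most the profit
without rewards. The base reward a ≥ 0 only lowers the net price to p - a.

What remains is a relaxed problem in (c, v): maximize `stepProfit` subject to c ≥ 0 and net price c
+ R·`beliefBelow c v` at most p. A small reward at very low qualities beats having none, and profits
above that benchmark confine v to a compact interval, so a maximum exists (`exists_stepProfit_max`).
The crux is that the price constraint binds (`binding`). If it were slack, v would be stationary; a
higher c would then raise profit by the inequality `mills_sub_sub_lt_of_le`, a contradiction. Hence
a = 0, and Lagrange multipliers yield the system (`solvesSystem_of_max`).

In that inequality, s = σε/σ, κ = σθ/σ and x, y, z are the standardized distances of v from c, v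
from μ_c and θ from c, so x = κy + sz. Stationarity in v reads s N(x) = N(z), and optimality of p
reads N((θ-p)/σ) = p/σ. Convexity of N reduces the claim to the largest admissible reward.

Part (3): as the cutoff x moves, a sales threshold becomes a quality threshold moving one for one
with x, whereas μ_x moves at the rate τ < 1; so x plus the expected reward is strictly increasing.
-/

lemma phi_eq (x : ℝ) : phi x = (√(2 * Real.pi))⁻¹ * Real.exp (-x ^ 2 / 2) := by
  simp [phi, gaussianPDFReal]

lemma phi_pos (x : ℝ) : 0 < phi x := gaussianPDFReal_pos _ _ _ one_ne_zero

lemma continuous_phi : Continuous phi := by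
  have : phi = fun x => (√(2 * Real.pi))⁻¹ * Real.exp (-x ^ 2 / 2) := funext phi_eq
  rw [this]; fun_prop

lemma hasDerivAt_phi (x : ℝ) : HasDerivAt phi (-x * phi x) x := by
  have h : phi = fun x => (√(2 * Real.pi))⁻¹ * Real.exp (-x ^ 2 / 2) := funext phi_eq
  have h1 : HasDerivAt (fun x : ℝ => -x ^ 2 / 2) (-x) x := by
    exact ((hasDerivAt_pow 2 x).neg.div_const 2).congr_deriv (by norm_num; ring)
  rw [phi_eq x, h]
  exact (h1.exp.const_mul (√(2 * Real.pi))⁻¹).congr_deriv (by ring)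

lemma phi_zero : phi 0 = (√(2 * Real.pi))⁻¹ := by simp [phi_eq]

lemma phi_neg (x : ℝ) : phi (-x) = phi x := by simp [phi_eq]

lemma phi_eq_zero_mul (x : ℝ) : phi x = phi 0 * Real.exp (-x ^ 2 / 2) := by
  rw [phi_zero, phi_eq]

lemma integrable_phi : Integrable phi := integrable_gaussianPDFReal 0 1

lemma Phi_eq_integral (x : ℝ) : Phi x = ∫ t in Iic x, phi t := by
  rw [Phi, cdf_eq_real, Measure.real, gaussianReal_apply_eq_integral _ one_ne_zero,
    ENNReal.toReal_ofReal]
  · rfl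
  · exact setIntegral_nonneg measurableSet_Iic fun t _ => (phi_pos t).le

lemma hasDerivAt_Phi (x : ℝ) : HasDerivAt Phi (phi x) x := by
  have h : Phi = fun x => Phi 0 + ∫ t in (0 : ℝ)..x, phi t := by
    ext x
    rw [Phi_eq_integral, Phi_eq_integral, ← intervalIntegral.integral_Iic_sub_Iic
      integrable_phi.integrableOn integrable_phi.integrableOn]
    ring
  rw [h]
  exact (intervalIntegral.integral_hasDerivAt_right (continuous_phi.intervalIntegrable _ _)
    (continuous_phi.stronglyMeasurableAtFilter _ _) continuous_phi.continuousAt).const_add _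

lemma continuous_Phi : Continuous Phi :=
  continuous_iff_continuousAt.2 fun x => (hasDerivAt_Phi x).continuousAt

lemma strictMono_Phi : StrictMono Phi :=
  strictMono_of_hasDerivAt_pos hasDerivAt_Phi phi_pos

lemma tendsto_Phi_atBot : Tendsto Phi atBot (𝓝 0) := tendsto_cdf_atBot _

lemma tendsto_Phi_atTop : Tendsto Phi atTop (𝓝 1) := tendsto_cdf_atTop _

lemma Phi_pos (x : ℝ) : 0 < Phi x :=
  (cdf_nonneg _ _).trans_lt (strictMono_Phi (sub_one_lt x))

lemma Phi_lt_one (x : ℝ) : Phi x < 1 :=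
  (strictMono_Phi (lt_add_one x)).trans_le (cdf_le_one _ _)

lemma Phi_neg (x : ℝ) : Phi (-x) = 1 - Phi x := by
  have hd : ∀ x, HasDerivAt (fun x => Phi (-x) + Phi x) 0 x := fun x => by
    have h1 := (hasDerivAt_Phi (-x)).scomp x (hasDerivAt_neg x)
    exact (h1.add (hasDerivAt_Phi x)).congr_deriv (by simp [phi_neg])
  have hc : ∀ y, Phi (-y) + Phi y = Phi (-x) + Phi x := fun y =>
    is_const_of_deriv_eq_zero (fun x => (hd x).differentiableAt) (fun x => (hd x).deriv) y x
  have hl : Tendsto (fun y => Phi (-y) + Phi y) atTop (𝓝 (0 + 1)) :=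
    (tendsto_Phi_atBot.comp tendsto_neg_atTop_atBot).add tendsto_Phi_atTop
  have := tendsto_nhds_unique (hl.congr hc) tendsto_const_nhds
  linarith

lemma Phi_zero : Phi 0 = 1 / 2 := by
  have := Phi_neg 0
  rw [neg_zero] at this
  linarith

lemma exists_Phi_eq {g : ℝ} (h0 : 0 < g) (h1 : g < 1) : ∃ y, Phi y = g :=
  mem_range_of_exists_le_of_exists_ge continuous_Phi
    ((tendsto_Phi_atBot.eventually (ge_mem_nhds h0)).exists)
    ((tendsto_Phi_atTop.eventually (le_mem_nhds h1)).exists)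

lemma phi_lt_phi {a b : ℝ} (ha : 0 ≤ a) (hab : a < b) : phi b < phi a := by
  rw [phi_eq, phi_eq]
  have : 0 < (√(2 * Real.pi))⁻¹ := by positivity
  refine mul_lt_mul_of_pos_left (Real.exp_lt_exp.2 ?_) this
  nlinarith

lemma phi_le_phi_zero (a : ℝ) : phi a ≤ phi 0 := by
  rw [phi_eq_zero_mul a]
  refine mul_le_of_le_one_right (phi_pos 0).le (Real.exp_le_one_iff.2 ?_)
  nlinarith [sq_nonneg a]

lemma Phi_sub_half_lt {b : ℝ} (hb : 0 < b) : Phi b - 1 / 2 < b * phi 0 := by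
  obtain ⟨ξ, hξ, h⟩ := exists_hasDerivAt_eq_slope Phi phi hb continuous_Phi.continuousOn
    fun x _ => hasDerivAt_Phi x
  have h2 := phi_lt_phi le_rfl hξ.1
  rw [h, Phi_zero, sub_zero, div_lt_iff₀ hb] at h2
  linarith

/-- Since φ decreases on [0, ∞), increments of Φ shrink there, so Φ - 1/2 is subadditive. -/
lemma Phi_add_le {a b : ℝ} (ha : 0 ≤ a) (hb : 0 ≤ b) :
    Phi (a + b) ≤ Phi a + Phi b - 1 / 2 := by
  have hd : ∀ x, HasDerivAt (fun x => Phi x - Phi (x + b)) (phi x - phi (x + b)) x := fun x =>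
    (hasDerivAt_Phi x).sub ((hasDerivAt_Phi (x + b)).comp_add_const x b)
  have hm : MonotoneOn (fun x => Phi x - Phi (x + b)) (Ici 0) := by
    refine monotoneOn_of_deriv_nonneg (convex_Ici 0)
      (fun x _ => (hd x).continuousAt.continuousWithinAt)
      (fun x _ => (hd x).differentiableAt.differentiableWithinAt) fun x hx => ?_
    rw [(hd x).deriv]
    rw [interior_Ici] at hx
    rcases hb.eq_or_lt with rfl | hb
    · simp
    · linarith [phi_lt_phi (le_of_lt hx) (lt_add_of_pos_right x hb)]
  have := hm (self_mem_Ici) (mem_Ici.2 ha) ha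
  simp only [zero_add, Phi_zero] at this
  linarith

lemma exp_neg_cubic_le {u : ℝ} (hu : 0 ≤ u) :
    1 - u + u ^ 2 / 2 - u ^ 3 / 6 ≤ Real.exp (-u) := by
  have he : ∀ x : ℝ, HasDerivAt (fun x => Real.exp (-x)) (-Real.exp (-x)) x := fun x => by
    simpa using (hasDerivAt_neg x).exp
  have h2 : ∀ x ∈ Ici (0 : ℝ), Real.exp (-x) ≤ 1 - x + x ^ 2 / 2 := by
    have hd : ∀ x : ℝ, HasDerivAt (fun x => 1 - x + x ^ 2 / 2 - Real.exp (-x))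
        (-1 + x + Real.exp (-x)) x := fun x => by
      exact ((((hasDerivAt_id x).const_sub 1).add ((hasDerivAt_pow 2 x).div_const 2)).sub
        (he x)).congr_deriv (by simp)
    have hm : MonotoneOn (fun x => 1 - x + x ^ 2 / 2 - Real.exp (-x)) (Ici 0) :=
      monotoneOn_of_deriv_nonneg (convex_Ici 0)
        (fun x _ => (hd x).continuousAt.continuousWithinAt)
        (fun x _ => (hd x).differentiableAt.differentiableWithinAt) fun x _ => by
          rw [(hd x).deriv]; linarith [Real.one_sub_le_exp_neg x]
    intro x hx
    have := hm self_mem_Ici hx hx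
    simp at this
    linarith
  have hd : ∀ x : ℝ, HasDerivAt (fun x => Real.exp (-x) - (1 - x + x ^ 2 / 2 - x ^ 3 / 6))
      ((1 - x + x ^ 2 / 2) - Real.exp (-x)) x := fun x => by
    exact ((he x).sub ((((hasDerivAt_id x).const_sub 1).add
      ((hasDerivAt_pow 2 x).div_const 2)).sub ((hasDerivAt_pow 3 x).div_const 6))).congr_deriv
      (by norm_num; ring)
  have hm : MonotoneOn (fun x => Real.exp (-x) - (1 - x + x ^ 2 / 2 - x ^ 3 / 6)) (Ici 0) :=
    monotoneOn_of_deriv_nonneg (convex_Ici 0)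
      (fun x _ => (hd x).continuousAt.continuousWithinAt)
      (fun x _ => (hd x).differentiableAt.differentiableWithinAt) fun x hx => by
        rw [(hd x).deriv]
        rw [interior_Ici] at hx
        linarith [h2 x (mem_Ici.2 (le_of_lt hx))]
  have := hm self_mem_Ici (mem_Ici.2 hu) hu
  simp at this
  linarith

/-- Integrates the cubic Taylor bound for exp(-x²/2). It serves the numerical values at 1/2 and 5/4.
-/
lemma Phi_lower_bound {x : ℝ} (hx : 0 ≤ x) :
    1 / 2 + phi 0 * (x - x ^ 3 / 6 + x ^ 5 / 40 - x ^ 7 / 336) ≤ Phi x := by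
  have hd : ∀ x : ℝ, HasDerivAt
      (fun x => Phi x - phi 0 * (x - x ^ 3 / 6 + x ^ 5 / 40 - x ^ 7 / 336))
      (phi x - phi 0 * (1 - x ^ 2 / 2 + x ^ 4 / 8 - x ^ 6 / 48)) x := fun x => by
    exact ((hasDerivAt_Phi x).sub (((((hasDerivAt_id x).sub
      ((hasDerivAt_pow 3 x).div_const 6)).add ((hasDerivAt_pow 5 x).div_const 40)).sub
      ((hasDerivAt_pow 7 x).div_const 336)).const_mul (phi 0))).congr_deriv
      (by norm_num; left; ring)
  have hm : MonotoneOn (fun x => Phi x - phi 0 * (x - x ^ 3 / 6 + x ^ 5 / 40 - x ^ 7 / 336))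
      (Ici 0) :=
    monotoneOn_of_deriv_nonneg (convex_Ici 0)
      (fun x _ => (hd x).continuousAt.continuousWithinAt)
      (fun x _ => (hd x).differentiableAt.differentiableWithinAt) fun x _ => by
        rw [(hd x).deriv, phi_eq_zero_mul x, ← mul_sub]
        refine mul_nonneg (phi_pos 0).le ?_
        have := exp_neg_cubic_le (u := x ^ 2 / 2) (by positivity)
        rw [neg_div]
        ring_nf at this ⊢
        linarith
  have := hm self_mem_Ici (mem_Ici.2 hx) hx
  simp [Phi_zero] at this
  linarith

lemma phi_zero_gt : 0.3989 < phi 0 := by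
  rw [phi_zero, lt_inv_comm₀ (by norm_num) (by positivity), Real.sqrt_lt' (by norm_num)]
  nlinarith [Real.pi_lt_d6]

lemma Phi_half_ge : 0.69 ≤ Phi (1 / 2) := by
  have := Phi_lower_bound (x := 1 / 2) (by norm_num)
  norm_num at this ⊢
  linarith [phi_zero_gt]

lemma Phi_five_fourths_ge : 0.89 ≤ Phi (5 / 4) := by
  have := Phi_lower_bound (x := 5 / 4) (by norm_num)
  norm_num at this ⊢
  linarith [phi_zero_gt]

lemma tendsto_phi_atBot : Tendsto phi atBot (𝓝 0) := by
  have h : phi = fun x => (√(2 * Real.pi))⁻¹ * Real.exp (-x ^ 2 / 2) := funext phi_eq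
  rw [h, show (0 : ℝ) = (√(2 * Real.pi))⁻¹ * 0 by simp]
  refine (Real.tendsto_exp_atBot.comp ?_).const_mul _
  have : Tendsto (fun x : ℝ => x ^ 2) atBot atTop := by
    simpa [Function.comp_def] using (tendsto_pow_atTop two_ne_zero).comp
      (tendsto_neg_atBot_atTop (G := ℝ))
  simp_rw [neg_div]
  exact tendsto_neg_atTop_atBot.comp (this.atTop_div_const (by norm_num))

lemma tendsto_mul_phi_atBot : Tendsto (fun x => x * phi x) atBot (𝓝 0) := by
  have hb : ∀ x : ℝ, ‖x * phi x‖ ≤ 2 * phi (x / 2) := by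
    intro x
    -- The ratio φ(x/2)/φ(x) is exp(3x²/8), which absorbs the factor x.
    have hx : |x| ≤ 2 * Real.exp (3 * x ^ 2 / 8) := by
      have h1 := Real.add_one_le_exp (3 * x ^ 2 / 8)
      have h2 : |x| ≤ 1 + x ^ 2 / 4 := by
        rw [abs_le]; constructor <;> nlinarith [sq_nonneg (x - 2), sq_nonneg (x + 2)]
      nlinarith [sq_nonneg x]
    have h3 : phi (x / 2) = Real.exp (3 * x ^ 2 / 8) * phi x := by
      rw [phi_eq_zero_mul x, phi_eq_zero_mul (x / 2), mul_left_comm, ← Real.exp_add]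
      ring_nf
    rw [norm_mul, Real.norm_eq_abs, Real.norm_of_nonneg (phi_pos x).le, h3, ← mul_assoc]
    exact mul_le_mul_of_nonneg_right hx (phi_pos x).le
  refine squeeze_zero_norm hb ?_
  have := (tendsto_phi_atBot.comp (tendsto_id.atBot_div_const (r := (2:ℝ)) (by norm_num))).const_mul 2
  simpa using this

end Normal

/-! ### Normal laws with general mean and standard deviation. -/

section NormalLaw

lemma normalLaw_eq (m s : ℝ) :
    normalLaw m s = gaussianReal m (NNReal.mk (s ^ 2) (sq_nonneg s)) := rfl

instance instIsProbabilityMeasureNormalLaw (m s : ℝ) : IsProbabilityMeasure (normalLaw m s) := by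
  rw [normalLaw_eq]; infer_instance

lemma normalVariance_ne_zero {s : ℝ} (hs : 0 < s) : NNReal.mk (s ^ 2) (sq_nonneg s) ≠ 0 := by
  intro h
  have := congrArg NNReal.toReal h
  exact hs.ne' (pow_eq_zero_iff two_ne_zero |>.1 this)

/-- The density of the normal law with mean `m` and standard deviation `s`. -/
noncomputable def normalDensity (m s v : ℝ) : ℝ := phi ((v - m) / s) / s

lemma gaussianPDFReal_eq_normalDensity (m : ℝ) {s : ℝ} (hs : 0 < s) (v : ℝ) :
    gaussianPDFReal m (NNReal.mk (s ^ 2) (sq_nonneg s)) v = normalDensity m s v := by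
  rw [normalDensity, phi_eq, gaussianPDFReal]
  change (√(2 * Real.pi * s ^ 2))⁻¹ * Real.exp (-(v - m) ^ 2 / (2 * s ^ 2)) = _
  rw [Real.sqrt_mul (by positivity), Real.sqrt_sq hs.le]
  field_simp

lemma normalDensity_pos (m : ℝ) {s : ℝ} (hs : 0 < s) (v : ℝ) : 0 < normalDensity m s v :=
  div_pos (phi_pos _) hs

lemma integrable_normalDensity (m : ℝ) {s : ℝ} (hs : 0 < s) :
    Integrable (normalDensity m s) := by
  rw [← funext (gaussianPDFReal_eq_normalDensity m hs)]
  exact integrable_gaussianPDFReal _ _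

lemma continuous_normalDensity (m s : ℝ) : Continuous (normalDensity m s) := by
  unfold normalDensity
  exact (continuous_phi.comp (by fun_prop)).div_const _

lemma integral_normalLaw (m : ℝ) {s : ℝ} (hs : 0 < s) (g : ℝ → ℝ) :
    ∫ v, g v ∂(normalLaw m s) = ∫ v, normalDensity m s v * g v := by
  rw [normalLaw_eq, integral_gaussianReal_eq_integral_smul (normalVariance_ne_zero hs)]
  simp_rw [gaussianPDFReal_eq_normalDensity m hs, smul_eq_mul]

lemma integral_normalDensity (m : ℝ) {s : ℝ} (hs : 0 < s) : ∫ v, normalDensity m s v = 1 := by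
  have := integral_normalLaw m hs (fun _ => 1)
  simpa using this.symm

lemma normalLaw_real_Iic (m : ℝ) {s : ℝ} (hs : 0 < s) (a : ℝ) :
    (normalLaw m s).real (Iic a) = Phi ((a - m) / s) := by
  have h : normalLaw m s = (gaussianReal 0 1).map (fun x => s * x + m) := by
    have h1 := gaussianReal_map_const_mul (μ := 0) (v := 1) s
    have h2 := gaussianReal_map_add_const (μ := s * 0) (v := (NNReal.mk (s ^ 2) (sq_nonneg s)) * 1) m
    rw [← h1, Measure.map_map (by fun_prop) (by fun_prop)] at h2
    rw [normalLaw_eq]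
    simp only [mul_zero, zero_add, mul_one] at h2
    rw [← h2]; rfl
  rw [h, map_measureReal_apply (by fun_prop) measurableSet_Iic, Phi, cdf_eq_real]
  congr 1
  ext x
  simp only [mem_preimage, mem_Iic]
  rw [le_div_iff₀ hs]
  constructor <;> intro h <;> linarith

lemma normalLaw_ac_volume (m : ℝ) {s : ℝ} (hs : 0 < s) : normalLaw m s ≪ volume :=
  gaussianReal_absolutelyContinuous _ (normalVariance_ne_zero hs)

lemma volume_ac_normalLaw (m : ℝ) {s : ℝ} (hs : 0 < s) : volume ≪ normalLaw m s :=
  gaussianReal_absolutelyContinuous' _ (normalVariance_ne_zero hs)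

lemma integrable_of_mem_Icc {μ : Measure ℝ} [IsFiniteMeasure μ] {g : ℝ → ℝ} (hg : Measurable g)
    {a b : ℝ} (h : ∀ v, g v ∈ Icc a b) : Integrable g μ :=
  Integrable.of_mem_Icc a b hg.aemeasurable (ae_of_all _ h)

lemma integrable_normalDensity_mul (m : ℝ) {s : ℝ} (hs : 0 < s) {g : ℝ → ℝ} (hg : Measurable g)
    {a b : ℝ} (h : ∀ v, g v ∈ Icc a b) : Integrable fun v => normalDensity m s v * g v := by
  refine (integrable_normalDensity m hs).mul_bdd (c := max |a| |b|) hg.aestronglyMeasurable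
    (ae_of_all _ fun v => ?_)
  exact abs_le_max_abs_abs (h v).1 (h v).2

end NormalLaw

/-! ### The ratio N = Φ/φ: monotonicity, convexity, and bounds involving N(0). -/

section Mills

/-- The ratio of the standard normal distribution function to the density. -/
noncomputable def mills (z : ℝ) : ℝ := Phi z / phi z

lemma mills_pos (z : ℝ) : 0 < mills z := div_pos (Phi_pos z) (phi_pos z)

lemma hasDerivAt_mills (z : ℝ) : HasDerivAt mills (1 + z * mills z) z := by
  refine ((hasDerivAt_Phi z).div (hasDerivAt_phi z) (phi_pos z).ne').congr_deriv ?_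
  have := (phi_pos z).ne'
  rw [mills]
  field_simp
  ring

lemma pos_of_hasDerivAt_pos_of_tendsto_atBot {f f' : ℝ → ℝ} {z : ℝ}
    (hd : ∀ t, HasDerivAt f (f' t) t) (hpos : ∀ t < z, 0 < f' t)
    (hl : Tendsto f atBot (𝓝 0)) : 0 < f z := by
  have hm : StrictMonoOn f (Iic z) := by
    refine strictMonoOn_of_deriv_pos (convex_Iic z)
      (fun x _ => (hd x).continuousAt.continuousWithinAt) fun x hx => ?_
    rw [interior_Iic] at hx
    rw [(hd x).deriv]
    exact hpos x hx
  have h1 : 0 ≤ f (z - 1) := by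
    refine le_of_tendsto hl ?_
    filter_upwards [eventually_le_atBot (z - 1)] with t ht
    exact hm.monotoneOn (by simp only [mem_Iic]; linarith) (by simp) ht
  exact h1.trans_lt (hm (by simp) self_mem_Iic (by linarith))

/-- The quantity is the integral of (z - t)φ(t) over t < z. Divided by φ(z) it is N'(z). -/
lemma phi_add_mul_Phi_pos (z : ℝ) : 0 < phi z + z * Phi z := by
  refine pos_of_hasDerivAt_pos_of_tendsto_atBot (f := fun t => phi t + z * Phi t)
    (f' := fun t => (z - t) * phi t) (z := z) (fun t => ?_)
    (fun t ht => mul_pos (sub_pos.2 ht) (phi_pos t)) ?_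
  · exact ((hasDerivAt_phi t).add ((hasDerivAt_Phi t).const_mul z)).congr_deriv (by ring)
  · simpa using tendsto_phi_atBot.add (tendsto_Phi_atBot.const_mul z)

/-- The quantity is the integral of (z - t)²φ(t) over t < z. Divided by φ(z) it is N''(z), and it
also controls the derivative of s N(sz) in s. -/
lemma mul_phi_add_mul_Phi_pos (z : ℝ) : 0 < z * phi z + (1 + z ^ 2) * Phi z := by
  have := pos_of_hasDerivAt_pos_of_tendsto_atBot
    (f := fun t => (1 + z ^ 2) * Phi t + 2 * z * phi t - t * phi t)
    (f' := fun t => (z - t) ^ 2 * phi t) (z := z) (fun t => ?_)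
    (fun t ht => mul_pos (pow_pos (sub_pos.2 ht) 2) (phi_pos t)) ?_
  · linarith
  · exact ((((hasDerivAt_Phi t).const_mul (1 + z ^ 2)).add
      ((hasDerivAt_phi t).const_mul (2 * z))).sub
      ((hasDerivAt_id t).mul (hasDerivAt_phi t))).congr_deriv (by simp; ring)
  · simpa using ((tendsto_Phi_atBot.const_mul (1 + z ^ 2)).add
      (tendsto_phi_atBot.const_mul (2 * z))).sub tendsto_mul_phi_atBot

lemma mills_mul_phi (z : ℝ) : mills z * phi z = Phi z := div_mul_cancel₀ _ (phi_pos z).ne'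

lemma one_add_mul_mills_pos (z : ℝ) : 0 < 1 + z * mills z := by
  have := div_pos (phi_add_mul_Phi_pos z) (phi_pos z)
  rwa [add_div, mul_div_assoc, div_self (phi_pos z).ne'] at this

lemma mills_add_mul_pos (z : ℝ) : 0 < mills z + z * (1 + z * mills z) := by
  have := div_pos (mul_phi_add_mul_Phi_pos z) (phi_pos z)
  rw [add_div, mul_div_assoc, mul_div_assoc, div_self (phi_pos z).ne', ← mills] at this
  linarith

lemma strictMono_mills : StrictMono mills :=
  strictMono_of_hasDerivAt_pos hasDerivAt_mills one_add_mul_mills_pos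

lemma convexOn_mills : ConvexOn ℝ univ mills := by
  refine Monotone.convexOn_univ_of_deriv (fun z => (hasDerivAt_mills z).differentiableAt) ?_
  have : deriv mills = fun z => 1 + z * mills z := funext fun z => (hasDerivAt_mills z).deriv
  rw [this]
  refine (strictMono_of_hasDerivAt_pos (f' := fun z => mills z + z * (1 + z * mills z))
    (fun z => ?_) mills_add_mul_pos).monotone
  exact (((hasDerivAt_id z).mul (hasDerivAt_mills z)).const_add 1).congr_deriv (by simp)

lemma strictMono_mul_mills_mul (z : ℝ) : StrictMono fun s => s * mills (s * z) := by
  refine strictMono_of_hasDerivAt_pos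
    (f' := fun s => mills (s * z) + s * z * (1 + s * z * mills (s * z))) (fun s => ?_)
    fun s => mills_add_mul_pos (s * z)
  have h := (hasDerivAt_mills (s * z)).comp s ((hasDerivAt_id s).mul_const z)
  exact ((hasDerivAt_id s).mul h).congr_deriv (by simp; ring)

lemma mills_zero_mul_phi_zero : 2 * mills 0 * phi 0 = 1 := by
  rw [mul_assoc, mills_mul_phi, Phi_zero]; norm_num

lemma mills_mul_exp (z : ℝ) : mills z * Real.exp (-z ^ 2 / 2) = 2 * mills 0 * Phi z := by
  rw [← mills_mul_phi z, phi_eq_zero_mul z]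
  linear_combination -(mills z * Real.exp (-z ^ 2 / 2)) * mills_zero_mul_phi_zero

lemma mills_eq (z : ℝ) : mills z = 2 * mills 0 * Phi z * Real.exp (z ^ 2 / 2) := by
  rw [← mills_mul_exp, mul_assoc, ← Real.exp_add]
  simp [neg_div]

lemma tendsto_mills_atBot : Tendsto mills atBot (𝓝 0) := by
  refine squeeze_zero' (Eventually.of_forall fun z => (mills_pos z).le)
    (g := fun z => -z⁻¹) ?_ (by simpa using (tendsto_inv_atBot_zero (𝕜 := ℝ)).neg)
  filter_upwards [eventually_lt_atBot 0] with z hz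
  have := one_add_mul_mills_pos z
  rw [← inv_neg, ← one_div, le_div_iff₀ (neg_pos.2 hz)]
  linarith

lemma mills_zero_ge : 1.25 ≤ mills 0 := by
  have h := mills_zero_mul_phi_zero
  have h1 : phi 0 ≤ 0.4 := by
    rw [phi_zero, inv_le_comm₀ (by positivity) (by norm_num), Real.le_sqrt' (by norm_num)]
    linarith [Real.pi_gt_d4]
  nlinarith [mills_pos 0]

lemma mills_mills_zero_ge : 4.1 ≤ mills (mills 0) := by
  have h0 := mills_zero_ge
  rw [mills_eq (mills 0)]
  have h1 : 0.89 ≤ Phi (mills 0) :=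
    Phi_five_fourths_ge.trans (strictMono_Phi.monotone (by linarith))
  have h2 : (2.08 : ℝ) ≤ Real.exp (mills 0 ^ 2 / 2) := by
    refine le_trans ?_ (Real.quadratic_le_exp_of_nonneg (by positivity))
    have h3 : (0.78 : ℝ) ≤ mills 0 ^ 2 / 2 := by nlinarith
    nlinarith
  calc (4.1 : ℝ) ≤ 2 * 1.25 * 0.89 * 2.08 := by norm_num
    _ ≤ _ := by gcongr

/-- With m = N(0), the difference of the two sides at z = m is N(m)/6 > 0, and an integrating factor
shows that it keeps its sign afterwards. -/
lemma mills_sub_mills_zero_le {z : ℝ} (hz : mills 0 ≤ z) :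
    mills (z - mills 0) - mills 0 ≤ mills z / 6 := by
  set m := mills 0 with hm
  have hm0 := mills_zero_ge
  have hmm := mills_mills_zero_ge
  rw [← hm] at hm0 hmm
  -- The slope 6 is admissible because N'(t) ≥ 1 + m N(m) ≥ 1 + 1.25 · 4.1 for t ≥ m.
  have hlin : MonotoneOn (fun t => mills t - 6 * t) (Ici m) := by
    have hd : ∀ t, HasDerivAt (fun t => mills t - 6 * t) (1 + t * mills t - 6) t := fun t =>
      ((hasDerivAt_mills t).sub ((hasDerivAt_id t).const_mul 6)).congr_deriv (by simp)
    refine monotoneOn_of_deriv_nonneg (convex_Ici m)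
      (fun x _ => (hd x).continuousAt.continuousWithinAt)
      (fun x _ => (hd x).differentiableAt.differentiableWithinAt) fun t ht => ?_
    rw [(hd t).deriv]
    rw [interior_Ici, mem_Ioi] at ht
    have := strictMono_mills ht
    nlinarith
  -- The Gaussian factor cancels N(t - m) from the derivative, since N' = 1 + tN.
  have hd : ∀ t, HasDerivAt
      (fun t => (mills t / 6 - mills (t - m) + m) * Real.exp (-(t - m) ^ 2 / 2))
      ((m * mills t / 6 - 5 / 6 - m * (t - m)) * Real.exp (-(t - m) ^ 2 / 2)) t := fun t => by
    have h1 := (((hasDerivAt_mills t).div_const 6).sub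
      ((hasDerivAt_mills (t - m)).comp_sub_const t m)).add_const m
    have h2 : HasDerivAt (fun t => Real.exp (-(t - m) ^ 2 / 2))
        (Real.exp (-(t - m) ^ 2 / 2) * (-(t - m))) t := by
      refine HasDerivAt.exp ?_
      exact ((((hasDerivAt_id t).sub_const m).pow 2).neg.div_const 2).congr_deriv
        (by norm_num; ring)
    exact (h1.mul h2).congr_deriv (by simp only [Pi.sub_apply]; ring)
  have hmono : MonotoneOn
      (fun t => (mills t / 6 - mills (t - m) + m) * Real.exp (-(t - m) ^ 2 / 2)) (Ici m) := by
    refine monotoneOn_of_deriv_nonneg (convex_Ici m)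
      (fun x _ => (hd x).continuousAt.continuousWithinAt)
      (fun x _ => (hd x).differentiableAt.differentiableWithinAt) fun t ht => ?_
    rw [(hd t).deriv]
    rw [interior_Ici, mem_Ioi] at ht
    have := hlin self_mem_Ici (mem_Ici.2 ht.le) ht.le
    simp only at this
    refine mul_nonneg ?_ (Real.exp_pos _).le
    nlinarith
  have h := hmono self_mem_Ici (mem_Ici.2 hz) hz
  simp only [sub_self] at h
  rw [← hm] at h
  have h3 : 0 ≤ (mills z / 6 - mills (z - m) + m) * Real.exp (-(z - m) ^ 2 / 2) := by
    refine le_trans ?_ h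
    have := mills_pos m
    exact mul_nonneg (by linarith) (Real.exp_pos _).le
  have := nonneg_of_mul_nonneg_left h3 (Real.exp_pos _)
  linarith

lemma antitone_mills_sub_sub (z : ℝ) : Antitone fun d => mills (z - d) - d := fun a b h =>
  sub_le_sub (strictMono_mills.monotone (by linarith)) h

lemma mills_sub_mul_le (z m : ℝ) {δ : ℝ} (h0 : 0 ≤ δ) (h1 : δ ≤ 1) :
    mills (z - δ * m) ≤ (1 - δ) * mills z + δ * mills (z - m) := by
  have := convexOn_mills.2 (mem_univ z) (mem_univ (z - m)) (sub_nonneg.2 h1) h0 (by ring)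
  simp only [smul_eq_mul] at this
  rwa [show (1 - δ) * z + δ * (z - m) = z - δ * m by ring] at this

/-! ### The inequality behind the binding price constraint. -/

section KeyInequality

variable {s κ x y z : ℝ}

/-- If y ≤ 0, then x ≤ sz, and s N(x) ≤ s N(sz) < N(z) because s N(sz) increases in s and s < 1. -/
lemma standardized_pos (hs : 0 < s) (hκ : 0 < κ) (hsq : s ^ 2 + κ ^ 2 = 1)
    (hx : x = κ * y + s * z) (hM : s * mills x = mills z) : 0 < y := by
  have hs1 : s < 1 := by nlinarith
  by_contra! hy
  have hxz : mills x ≤ mills (s * z) := strictMono_mills.monotone (by nlinarith)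
  have h1 := strictMono_mul_mills_mul z hs1
  simp only [one_mul] at h1
  nlinarith

/-- Subadditivity gives Φ(x) ≤ Φ(y) + Φ(z) - 1/2; the rest is 2(Φ(y) - 1/2)(Φ(z) - 1/2) ≥ 0. -/
lemma Phi_rotation_le (hs : 0 < s) (hκ : 0 < κ) (hsq : s ^ 2 + κ ^ 2 = 1)
    (hx : x = κ * y + s * z) (hy : 0 ≤ y) (hz : 0 ≤ z) : Phi x ≤ 2 * Phi y * Phi z := by
  have hs1 : s < 1 := by nlinarith
  have hκ1 : κ < 1 := by nlinarith
  have h := Phi_add_le (mul_nonneg hκ.le hy) (mul_nonneg hs.le hz)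
  have h1 : Phi (κ * y) ≤ Phi y := strictMono_Phi.monotone (by nlinarith)
  have h2 : Phi (s * z) ≤ Phi z := strictMono_Phi.monotone (by nlinarith)
  have h3 : 1 / 2 ≤ Phi y := Phi_zero ▸ strictMono_Phi.monotone hy
  have h4 : 1 / 2 ≤ Phi z := Phi_zero ▸ strictMono_Phi.monotone hz
  rw [hx]
  nlinarith [mul_nonneg (sub_nonneg.2 h3) (sub_nonneg.2 h4)]

/-- The stationarity condition gives Φ(z) = sΦ(x) exp((x² - z²)/2), and y² + z² - x² = (sy - κz)²
because x is a coordinate of the rotated vector (y, z). -/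
lemma Phi_mul_exp_le (hs : 0 < s) (hsq : s ^ 2 + κ ^ 2 = 1)
    (hx : x = κ * y + s * z) (hM : s * mills x = mills z) :
    Phi z * Real.exp (-y ^ 2 / 2) ≤ s * Phi x := by
  have h := mills_zero_ge
  have h1 : Phi z = s * Phi x * Real.exp ((x ^ 2 - z ^ 2) / 2) := by
    have h2 := mills_mul_exp z
    rw [← hM, mills_eq x, show s * (2 * mills 0 * Phi x * Real.exp (x ^ 2 / 2)) *
      Real.exp (-z ^ 2 / 2) = 2 * mills 0 * (s * Phi x * (Real.exp (x ^ 2 / 2) *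
      Real.exp (-z ^ 2 / 2))) by ring, ← Real.exp_add] at h2
    have h3 := mul_left_cancel₀ (by positivity) h2
    rw [← h3]
    ring_nf
  rw [h1, mul_assoc, ← Real.exp_add]
  refine mul_le_of_le_one_right (mul_pos hs (Phi_pos x)).le (Real.exp_le_one_iff.2 ?_)
  have : y ^ 2 + z ^ 2 - x ^ 2 = (s * y - κ * z) ^ 2 := by
    rw [hx]; linear_combination -(y ^ 2 + z ^ 2) * hsq
  nlinarith [sq_nonneg (s * y - κ * z)]

/-- The bound on the exponential weight beyond `mills 0`. -/
lemma exp_bound_of_mills_zero_lt (hs : 0 < s) (hκ : 0 < κ) (hsq : s ^ 2 + κ ^ 2 = 1)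
    (hx : x = κ * y + s * z) (hM : s * mills x = mills z) (hz : mills 0 < z)
    (hd : 2 * (s / κ) * Phi y < 1) :
    Real.exp (-y ^ 2 / 2) < 2 * (s / κ) * Phi y * (5 / 6) := by
  have hm := mills_zero_ge
  have hs1 : s < 1 := by nlinarith
  have hκ1 : κ < 1 := by nlinarith
  have hy := standardized_pos hs hκ hsq hx hM
  have hxz : z < x := strictMono_mills.lt_iff_lt.1 (by nlinarith [mills_pos x])
  have h1 : 1 / 2 < Phi y := Phi_zero ▸ strictMono_Phi hy
  have hsκ : s < κ := by
    have : s / κ < 1 := by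
      have := div_pos hs hκ
      nlinarith
    rwa [div_lt_one hκ] at this
  have hyz : z * (1 - s) ≤ κ * y := by nlinarith
  -- If y < 1/2, then 1.25(1 - s) ≤ κ/2 forces s > 0.72, whereas s < κ means s < 1/√2.
  have hy2 : 1 / 2 ≤ y := by
    have h3 : 1.25 * (1 - s) ≤ κ * y := le_trans (by nlinarith) hyz
    by_contra! h
    have h4 : 1.25 * (1 - s) ≤ κ / 2 := by nlinarith
    nlinarith
  have hΦy : 0.69 ≤ Phi y := Phi_half_ge.trans (strictMono_Phi.monotone hy2)
  have hΦz : 0.89 ≤ Phi z := Phi_five_fourths_ge.trans (strictMono_Phi.monotone (by linarith))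
  have hE := Phi_mul_exp_le hs hsq hx hM
  have hΦx := Phi_lt_one x
  have h5 : Phi z * Real.exp (-y ^ 2 / 2) < s := by nlinarith
  have h6 : s ≤ Phi z * (2 * (s / κ) * Phi y * (5 / 6)) := by
    rw [show Phi z * (2 * (s / κ) * Phi y * (5 / 6)) = s * (Phi z * Phi y * (5 / 3) / κ) by ring]
    refine le_mul_of_one_le_right hs.le ?_
    rw [le_div_iff₀ hκ]
    nlinarith
  exact lt_of_mul_lt_mul_left (h5.trans_le h6) (Phi_pos z).le

/-- For s ≤ 0.74 the bound exp(-y²/2) ≤ s/Φ(z) ≤ 0.74/0.89 suffices. For larger s the last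
hypothesis forces y to be large: y ≥ 1.06 Φ(y), which is bootstrapped from Φ(y) > 1/2 to y ≥ 0.73.
-/
lemma exp_lt_of_mills_zero_le (hs : 0 < s) (hκ : 0 < κ) (hsq : s ^ 2 + κ ^ 2 = 1)
    (hx : x = κ * y + s * z) (hM : s * mills x = mills z) (hz : mills 0 < z)
    (hd : 2 * mills 0 * (s / κ) * Phi y < z) :
    Real.exp (-y ^ 2 / 2) < 5 / 6 := by
  have hm := mills_zero_ge
  have hs1 : s < 1 := by nlinarith
  have hκ1 : κ < 1 := by nlinarith
  rcases le_or_gt s 0.74 with h | h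
  · have hΦz : 0.89 ≤ Phi z := Phi_five_fourths_ge.trans (strictMono_Phi.monotone (by linarith))
    have hE := Phi_mul_exp_le hs hsq hx hM
    have hΦx := Phi_lt_one x
    have := Real.exp_pos (-y ^ 2 / 2)
    nlinarith
  · have hy := standardized_pos hs hκ hsq hx hM
    have hxz : z < x := strictMono_mills.lt_iff_lt.1 (by nlinarith [mills_pos x])
    have hyz : z * (1 - s) ≤ κ * y := by nlinarith
    have hkey : 1.06 * Phi y ≤ y := by
      have h1 : 2 * mills 0 * s * Phi y < z * κ := by
        rw [show 2 * mills 0 * (s / κ) * Phi y = 2 * mills 0 * s * Phi y / κ by ring,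
          div_lt_iff₀ hκ] at hd
        exact hd
      have h2 : 2 * 1.25 * s * Phi y ≤ 2 * mills 0 * s * Phi y := by
        have := Phi_pos y
        gcongr
      have h3 : z * κ ≤ (1 + s) * y := by
        have : κ * (z * κ) ≤ κ * ((1 + s) * y) := by
          have : κ ^ 2 = (1 - s) * (1 + s) := by linear_combination hsq
          nlinarith
        exact le_of_mul_le_mul_left this hκ
      have h4 := Phi_pos y
      have h5 : 2.5 * s * Phi y ≤ (1 + s) * y := by linarith
      have h6 : 1.06 * (1 + s) ≤ 2.5 * s := by linarith
      have h7 : (1 + s) * (1.06 * Phi y) ≤ (1 + s) * y := by nlinarith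
      exact le_of_mul_le_mul_left h7 (by linarith)
    have h1 : 1 / 2 < Phi y := Phi_zero ▸ strictMono_Phi hy
    have hΦy : 0.69 ≤ Phi y := Phi_half_ge.trans (strictMono_Phi.monotone (by linarith))
    have hy3 : 0.73 ≤ y := by linarith
    have h8 : -y ^ 2 / 2 ≤ -0.266 := by nlinarith
    have h9 : Real.exp (-y ^ 2 / 2) ≤ Real.exp (-0.266) := Real.exp_le_exp.2 h8
    refine h9.trans_lt ?_
    rw [Real.exp_neg, inv_lt_comm₀ (Real.exp_pos _) (by norm_num)]
    have := Real.add_one_le_exp 0.266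
    norm_num at this ⊢
    linarith

/-- Write m = N(0), d = δm. The function N(z - d) - d is convex and decreasing in d, so for δ ≤ 1 it
lies below the chord between d = 0 and d = m, and for δ ≥ 1 below its value at d = m. That value is
at most 0 if z ≤ m and at most N(z)/6 if z > m; the bounds on exp(-y²/2) do the rest. Negative z is
compared directly through x ≤ y. -/
lemma mills_sub_sub_lt (hs : 0 < s) (hκ : 0 < κ) (hsq : s ^ 2 + κ ^ 2 = 1)
    (hx : x = κ * y + s * z) (hM : s * mills x = mills z) :
    mills (z - 2 * mills 0 * (s / κ) * Phi y) - 2 * mills 0 * (s / κ) * Phi y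
      < mills z * (1 - Real.exp (-y ^ 2 / 2)) := by
  have hm := mills_zero_ge
  have hs1 : s < 1 := by nlinarith
  have hκ1 : κ < 1 := by nlinarith
  have hy := standardized_pos hs hκ hsq hx hM
  have hΦ := Phi_pos y
  have hN := mills_pos z
  set d := 2 * mills 0 * (s / κ) * Phi y with hd
  have hdpos : 0 < d := by positivity
  have hE1 : Real.exp (-y ^ 2 / 2) < 1 := Real.exp_lt_one_iff.2 (by nlinarith [sq_pos_of_pos hy])
  have hE0 := Real.exp_pos (-y ^ 2 / 2)
  rcases lt_or_ge z 0 with hz | hz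
  · have hxy : x ≤ y := by
      rcases le_or_gt 0 x with h | h
      · by_contra! hc
        nlinarith
      · linarith
    have h1 : mills z * Real.exp (-y ^ 2 / 2) ≤ κ * d := by
      calc mills z * Real.exp (-y ^ 2 / 2) = s * mills x * Real.exp (-y ^ 2 / 2) := by rw [hM]
        _ ≤ s * mills y * Real.exp (-y ^ 2 / 2) := by
            have := strictMono_mills.monotone hxy
            gcongr
        _ = κ * d := by
            rw [mul_assoc, mills_mul_exp, hd]; field_simp
    have h2 : mills (z - d) < mills z := strictMono_mills (by linarith)
    nlinarith
  set δ := 2 * (s / κ) * Phi y with hδ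
  have hδd : d = δ * mills 0 := by rw [hd, hδ]; ring
  have hδ0 : 0 < δ := by positivity
  have hEδ : Real.exp (-y ^ 2 / 2) ≤ κ * δ := by
    have h1 := Phi_mul_exp_le hs hsq hx hM
    have h2 := Phi_rotation_le hs hκ hsq hx hy.le hz
    have h3 : κ * δ = 2 * s * Phi y := by rw [hδ]; field_simp
    have h4 : Phi z * Real.exp (-y ^ 2 / 2) ≤ Phi z * (κ * δ) := by rw [h3]; nlinarith
    exact le_of_mul_le_mul_left h4 (Phi_pos z)
  rcases le_or_gt z (mills 0) with hzm | hzm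
  · have h0 : mills (z - mills 0) - mills 0 ≤ 0 :=
      sub_nonpos.2 (strictMono_mills.monotone (by linarith))
    rcases le_or_gt 1 δ with h | h
    · have h1 : mills (z - d) - d ≤ mills (z - mills 0) - mills 0 :=
        antitone_mills_sub_sub z (by nlinarith)
      nlinarith
    · have h1 := mills_sub_mul_le z (mills 0) hδ0.le h.le
      rw [← hδd] at h1
      have h2 : mills z * Real.exp (-y ^ 2 / 2) < mills z * δ :=
        mul_lt_mul_of_pos_left (by nlinarith) hN
      have h3 := mul_nonpos_of_nonneg_of_nonpos hδ0.le h0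
      linarith
  · rcases le_or_gt z d with h | h
    · have h1 : mills (z - d) - d ≤ mills (z - z) - z := antitone_mills_sub_sub z h
      rw [sub_self] at h1
      nlinarith
    have h0 := mills_sub_mills_zero_le hzm.le
    rcases le_or_gt 1 δ with h' | h'
    · have h1 : mills (z - d) - d ≤ mills (z - mills 0) - mills 0 :=
        antitone_mills_sub_sub z (by nlinarith)
      have := exp_lt_of_mills_zero_le hs hκ hsq hx hM hzm h
      nlinarith
    · have h1 := mills_sub_mul_le z (mills 0) hδ0.le h'.le
      rw [← hδd] at h1
      have h2 := exp_bound_of_mills_zero_lt hs hκ hsq hx hM hzm h'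
      nlinarith

/-- At a price below the optimal one, the marginal profit from a higher cutoff is positive. -/
theorem mills_sub_sub_lt_of_le (hs : 0 < s) (hκ : 0 < κ) (hsq : s ^ 2 + κ ^ 2 = 1)
    (hx : x = κ * y + s * z) (hM : s * mills x = mills z) {ρ d : ℝ} (hρ0 : 0 < ρ) (hρ1 : ρ ≤ 1)
    (hd : ρ * (2 * mills 0 * (s / κ) * Phi y) ≤ d) :
    mills (z - d) - d < mills z * (1 - ρ * Real.exp (-y ^ 2 / 2)) := by
  refine (antitone_mills_sub_sub z hd).trans_lt ?_
  have h1 := mills_sub_sub_lt hs hκ hsq hx hM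
  have h2 := mills_sub_mul_le z (2 * mills 0 * (s / κ) * Phi y) hρ0.le hρ1
  simp only
  nlinarith

end KeyInequality

end Mills

/-! ### Expectations of functions of bounded oscillation under a shift of the mean. -/

section TotalVariation

lemma exists_lower_bound_of_spread {g : ℝ → ℝ} {B : ℝ} (hB : ∀ v w, g v - g w ≤ B) :
    ∃ a, (∀ v, a ≤ g v) ∧ (∀ v, g v ≤ a + B) ∧ ∀ b, (∀ v, b ≤ g v) → b ≤ a := by
  have hbdd : BddBelow (range g) := ⟨g 0 - B, by rintro _ ⟨v, rfl⟩; linarith [hB 0 v]⟩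
  refine ⟨sInf (range g), fun v => csInf_le hbdd (mem_range_self v), fun v => ?_, fun b hb => ?_⟩
  · have : g v - B ≤ sInf (range g) := le_csInf (range_nonempty g) (by
      rintro _ ⟨w, rfl⟩; linarith [hB v w])
    linarith
  · exact le_csInf (range_nonempty g) (by rintro _ ⟨w, rfl⟩; exact hb w)

lemma normalDensity_le_of_sq_le {m m' s v : ℝ} (hs : 0 < s) (h : (v - m') ^ 2 ≤ (v - m) ^ 2) :
    normalDensity m s v ≤ normalDensity m' s v := by
  rw [normalDensity, normalDensity, phi_eq, phi_eq]
  have : (0 : ℝ) < (√(2 * Real.pi))⁻¹ := by positivity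
  gcongr ?_ / _
  refine mul_le_mul_of_nonneg_left (Real.exp_le_exp.2 ?_) this.le
  rw [div_pow, div_pow]
  gcongr

/-- The extremal function is a step of height B at the midpoint k of the means, where the two
densities cross. It yields B(2Φ((m' - m)/(2s)) - 1), and concavity of Φ on [0, ∞) bounds this. -/
lemma integral_sub_integral_normalLaw_lt {g : ℝ → ℝ} (hg : Measurable g) {B s m m' : ℝ}
    (hspread : ∀ v w, g v - g w ≤ B) (hB : 0 < B) (hs : 0 < s) (hm : m < m') :
    ∫ v, g v ∂(normalLaw m s) - ∫ v, g v ∂(normalLaw m' s) < B * ((m' - m) / s) * phi 0 := by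
  obtain ⟨a, ha, haB, -⟩ := exists_lower_bound_of_spread hspread
  set k := (m + m') / 2 with hk
  -- The excess of the extremal step over g - a has the same sign as the difference of the densities
  -- on each side of k.
  let q : ℝ → ℝ := fun v => (Iic k).indicator (fun _ => B) v - (g v - a)
  have hind : Measurable ((Iic k).indicator fun _ : ℝ => B) :=
    measurable_const.indicator measurableSet_Iic
  have hq : Measurable q := hind.sub (hg.sub_const a)
  have hind01 : ∀ v, (Iic k).indicator (fun _ => B) v ∈ Icc 0 B := fun v => by
    by_cases h : v ∈ Iic k <;> simp [h, hB.le]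
  have hqb : ∀ v, q v ∈ Icc (-B) B := fun v => by
    have h1 := hind01 v
    have h2 := ha v
    have h3 := haB v
    constructor <;> simp only [q] <;> linarith [h1.1, h1.2]
  have hint : ∀ n, ∫ v, q v ∂(normalLaw n s) =
      B * Phi ((k - n) / s) - (∫ v, g v ∂(normalLaw n s) - a) := fun n => by
    have hgi : Integrable g (normalLaw n s) := integrable_of_mem_Icc hg fun v => ⟨ha v, haB v⟩
    have hgi' : Integrable (fun v => g v - a) (normalLaw n s) := hgi.sub (integrable_const a)
    simp only [q]
    rw [integral_sub (integrable_of_mem_Icc hind hind01) hgi',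
      integral_sub hgi (integrable_const a), integral_indicator_const _ measurableSet_Iic,
      normalLaw_real_Iic n hs]
    simp [mul_comm]
  have hpos : 0 ≤ ∫ v, q v ∂(normalLaw m s) - ∫ v, q v ∂(normalLaw m' s) := by
    rw [integral_normalLaw m hs, integral_normalLaw m' hs, ← integral_sub
      (integrable_normalDensity_mul m hs hq hqb) (integrable_normalDensity_mul m' hs hq hqb)]
    refine integral_nonneg fun v => ?_
    simp only [Pi.zero_apply]
    rw [← sub_mul]
    rcases le_or_gt v k with h | h
    · refine mul_nonneg (sub_nonneg.2 (normalDensity_le_of_sq_le hs (by nlinarith))) ?_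
      simp only [q, indicator_of_mem (mem_Iic.2 h)]
      linarith [haB v]
    · refine mul_nonneg_of_nonpos_of_nonpos
        (sub_nonpos.2 (normalDensity_le_of_sq_le hs (by nlinarith))) ?_
      simp only [q, indicator_of_notMem (notMem_Iic.2 h)]
      linarith [ha v]
  rw [hint, hint] at hpos
  have hb : 0 < (m' - m) / (2 * s) := div_pos (sub_pos.2 hm) (by positivity)
  have h1 : (k - m) / s = (m' - m) / (2 * s) := by rw [hk]; field_simp; ring
  have h2 : (k - m') / s = -((m' - m) / (2 * s)) := by rw [hk]; field_simp; ring
  rw [h1, h2, Phi_neg] at hpos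
  have h3 := Phi_sub_half_lt hb
  have h4 : (m' - m) / s = 2 * ((m' - m) / (2 * s)) := by field_simp
  rw [h4]
  nlinarith

end TotalVariation

/-! ### Monotone payoffs and existence of equilibria under the spread constraint. -/

namespace Market

variable (M : Market)

lemma σ_pos : 0 < M.σ := Real.sqrt_pos.2 (by have := M.σε_pos; positivity)

lemma σ_sq : M.σ ^ 2 = M.σε ^ 2 + M.σθ ^ 2 := Real.sq_sqrt (by positivity)

lemma τ_eq : M.τ = M.σθ ^ 2 / M.σ ^ 2 := by rw [τ, σ_sq]

lemma one_sub_τ_eq : 1 - M.τ = M.σε ^ 2 / M.σ ^ 2 := by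
  have := M.σ_pos
  rw [τ_eq, eq_div_iff (by positivity), sub_mul, div_mul_cancel₀ _ (by positivity), σ_sq]
  ring

lemma τ_pos : 0 < M.τ := by
  have := M.σ_pos; have := M.σθ_pos
  rw [τ_eq]; positivity

lemma τ_lt_one : M.τ < 1 := by
  have := M.σ_pos; have := M.σε_pos
  have : 0 < 1 - M.τ := by rw [one_sub_τ_eq]; positivity
  linarith

lemma σv_eq : M.σv = M.σε * M.σθ / M.σ := rfl

lemma σv_pos : 0 < M.σv := div_pos (mul_pos M.σε_pos M.σθ_pos) M.σ_pos

lemma spreadBound_pos : 0 < M.spreadBound := by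
  have := M.σ_pos; have := M.σθ_pos; have := M.σε_pos
  rw [spreadBound]; positivity

/-- This calibration turns the total variation estimate into slope at most 1 in the valuation, the
posterior mean having slope τ. -/
lemma spreadBound_mul_τ_mul_phi_zero : M.spreadBound * M.τ * phi 0 = M.σv := by
  have := M.σ_pos; have := M.σθ_pos; have := M.σε_pos
  rw [spreadBound, τ_eq, σv_eq, phi_zero]
  have : (0 : ℝ) < √(2 * Real.pi) := by positivity
  field_simp

lemma μ_sub_μ (x y : ℝ) : M.μ x - M.μ y = M.τ * (x - y) := by rw [μ, μ]; ring

instance (x : ℝ) : IsProbabilityMeasure (M.posterior x) := by unfold posterior; infer_instance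

lemma expectedReward_sub_lt {g : ℝ → ℝ} (hg : Measurable g)
    (hspread : ∀ v w, g v - g w ≤ M.spreadBound) {x y : ℝ} (hxy : x < y) :
    M.expectedReward g x - M.expectedReward g y < y - x := by
  have hμ : M.μ x < M.μ y := by
    have := M.μ_sub_μ y x
    have := mul_pos M.τ_pos (sub_pos.2 hxy)
    linarith
  have h := integral_sub_integral_normalLaw_lt hg hspread M.spreadBound_pos M.σv_pos hμ
  have h2 : M.spreadBound * ((M.μ y - M.μ x) / M.σv) * phi 0 = y - x := by
    rw [μ_sub_μ, ← M.spreadBound_mul_τ_mul_phi_zero]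
    have := M.spreadBound_pos; have := M.τ_pos; have := phi_pos 0
    field_simp
  rwa [h2] at h

lemma strictMono_add_expectedReward {g : ℝ → ℝ} (hg : Measurable g)
    (hspread : ∀ v w, g v - g w ≤ M.spreadBound) :
    StrictMono fun x => x + M.expectedReward g x := fun x y hxy => by
  have := M.expectedReward_sub_lt hg hspread hxy
  simp only
  linarith

/-- Applying the slope bound to g and to -g makes the expected reward 1-Lipschitz. -/
lemma continuous_expectedReward {g : ℝ → ℝ} (hg : Measurable g)
    (hspread : ∀ v w, g v - g w ≤ M.spreadBound) : Continuous (M.expectedReward g) := by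
  have hneg : ∀ x, M.expectedReward (fun v => -g v) x = -M.expectedReward g x := fun x =>
    integral_neg _
  have hle : ∀ x y, x ≤ y → |M.expectedReward g x - M.expectedReward g y| ≤ y - x := by
    intro x y hxy
    rcases hxy.eq_or_lt with rfl | hxy
    · simp
    have h1 := M.expectedReward_sub_lt hg hspread hxy
    have h2 := M.expectedReward_sub_lt hg.neg (fun v w => by
      simp only [Pi.neg_apply]; linarith [hspread w v]) hxy
    change M.expectedReward (fun v => -g v) x - M.expectedReward (fun v => -g v) y < _ at h2
    rw [hneg, hneg] at h2
    rw [abs_le]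
    constructor <;> linarith
  refine (LipschitzWith.of_dist_le_mul (K := 1) fun x y => ?_).continuous
  rw [Real.dist_eq, Real.dist_eq, NNReal.coe_one, one_mul]
  rcases le_total x y with h | h
  · rw [abs_sub_comm x y, abs_of_nonneg (sub_nonneg.2 h)]
    exact hle x y h
  · rw [abs_of_nonneg (sub_nonneg.2 h), abs_sub_comm]
    exact hle y x h

lemma continuous_sales (c : ℝ) : Continuous (M.sales c) := by
  unfold sales
  exact continuous_Phi.comp (by fun_prop)

lemma sales_mem_Icc (c v : ℝ) : M.sales c v ∈ Icc (0 : ℝ) 1 := ⟨(Phi_pos _).le, (Phi_lt_one _).le⟩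

lemma measurable_program_sales {p : ℝ} {r : ℝ → ℝ} (hr : M.IsSpreadProgram p r) (c : ℝ) :
    Measurable fun v => r (M.sales c v) :=
  hr.measurable.comp (M.continuous_sales c).measurable

lemma spread_program_sales {p : ℝ} {r : ℝ → ℝ} (hr : M.IsSpreadProgram p r) (c v w : ℝ) :
    r (M.sales c v) - r (M.sales c w) ≤ M.spreadBound :=
  hr.spread _ (M.sales_mem_Icc c v) _ (M.sales_mem_Icc c w)

lemma strictMono_payoff {p : ℝ} {r : ℝ → ℝ} (hr : M.IsSpreadProgram p r) (c : ℝ) :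
    StrictMono (M.payoff p r c) := fun x y hxy => by
  have := M.strictMono_add_expectedReward (M.measurable_program_sales hr c)
    (M.spread_program_sales hr c) hxy
  simp only at this
  rw [payoff, payoff]
  linarith

lemma isEquilibrium_iff {p : ℝ} {r : ℝ → ℝ} (hr : M.IsSpreadProgram p r) (c : ℝ) :
    M.IsEquilibrium p r c ↔ c + M.expectedReward (fun v => r (M.sales c v)) c = p := by
  have hmono := M.strictMono_payoff hr c
  have hcont : Continuous (M.payoff p r c) := by
    have := M.continuous_expectedReward (M.measurable_program_sales hr c)
      (M.spread_program_sales hr c)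
    unfold payoff
    fun_prop
  have hiff : c + M.expectedReward (fun v => r (M.sales c v)) c = p ↔ M.payoff p r c c = 0 := by
    rw [payoff]
    constructor <;> intro h <;> linarith
  rw [hiff]
  constructor
  · intro h
    refine le_antisymm (not_lt.1 fun h0 => lt_irrefl c ((h c).2 h0)) ?_
    -- Payoffs are positive to the right of c, so continuity gives a nonnegative payoff at c.
    refine ge_of_tendsto (hcont.continuousWithinAt (s := Ioi c)) ?_
    filter_upwards [self_mem_nhdsWithin] with x hx
    exact ((h x).1 hx).le
  · intro h x
    rw [← h, hmono.lt_iff_lt]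

/-- Measuring quality relative to the cutoff makes the program independent of c and moves only the
mean of the belief; continuity in c follows even for discontinuous r. -/
lemma expectedReward_shift {r : ℝ → ℝ} (hr : Measurable r) (c : ℝ) :
    M.expectedReward (fun v => r (M.sales c v)) c =
      M.expectedReward (fun v => r (M.sales 0 v)) (-((1 - M.τ) / M.τ) * c) := by
  have hτ := M.τ_pos
  have hμ : M.μ c = M.μ (-((1 - M.τ) / M.τ) * c) + c := by
    rw [μ, μ]; field_simp; ring
  have hmap : M.posterior c = (M.posterior (-((1 - M.τ) / M.τ) * c)).map (fun u => u + c) := by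
    rw [posterior, posterior, normalLaw_eq, normalLaw_eq, gaussianReal_map_add_const, hμ]
  have hm : Measurable fun v => r (M.sales c v) := hr.comp (M.continuous_sales c).measurable
  rw [expectedReward, hmap, integral_map (by fun_prop) hm.aestronglyMeasurable, expectedReward]
  simp [sales]

lemma exists_isEquilibrium {p : ℝ} {r : ℝ → ℝ} (hr : M.IsSpreadProgram p r) :
    ∃ c, M.IsEquilibrium p r c := by
  have hcont : Continuous fun c => c + M.expectedReward (fun v => r (M.sales c v)) c := by
    simp_rw [M.expectedReward_shift hr.measurable]
    have := M.continuous_expectedReward (M.measurable_program_sales hr 0)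
      (M.spread_program_sales hr 0)
    fun_prop
  have hmem : ∀ c, M.expectedReward (fun v => r (M.sales c v)) c ∈ Icc 0 p := fun c => by
    have hb : ∀ v, r (M.sales c v) ∈ Icc 0 p := fun v => hr.mem_Icc _ (M.sales_mem_Icc c v)
    refine ⟨integral_nonneg fun v => (hb v).1, ?_⟩
    have := integral_mono (μ := M.posterior c)
      (integrable_of_mem_Icc (M.measurable_program_sales hr c) hb) (integrable_const p)
      fun v => (hb v).2
    rw [expectedReward]
    simpa using this
  have hp : 0 ≤ p := (hmem 0).1.trans (hmem 0).2
  obtain ⟨c, -, hc⟩ := intermediate_value_Icc hp hcont.continuousOn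
    (show p ∈ Icc _ _ from ⟨by simpa using (hmem 0).2, by linarith [(hmem p).1]⟩)
  exact ⟨c, (M.isEquilibrium_iff hr c).2 hc⟩

end Market

/-! ### Integrals over half-lines as functions of the endpoint. -/

section HalfLine

lemma hasDerivAt_integral_Iic {h : ℝ → ℝ} (hc : Continuous h) (hi : Integrable h) (x : ℝ) :
    HasDerivAt (fun x => ∫ t in Iic x, h t) (h x) x := by
  have h1 : (fun x => ∫ t in Iic x, h t) =
      fun x => (∫ t in Iic (0 : ℝ), h t) + ∫ t in (0 : ℝ)..x, h t := by
    ext x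
    rw [← intervalIntegral.integral_Iic_sub_Iic hi.integrableOn hi.integrableOn]
    ring
  rw [h1]
  exact (intervalIntegral.integral_hasDerivAt_right (hc.intervalIntegrable _ _)
    (hc.stronglyMeasurableAtFilter _ _) hc.continuousAt).const_add _

lemma hasDerivAt_integral_Ioi {h : ℝ → ℝ} (hc : Continuous h) (hi : Integrable h) (x : ℝ) :
    HasDerivAt (fun x => ∫ t in Ioi x, h t) (-h x) x := by
  have h1 : (fun x => ∫ t in Ioi x, h t) = fun x => (∫ t, h t) - ∫ t in Iic x, h t := by
    ext x
    rw [← intervalIntegral.integral_Iic_add_Ioi hi.integrableOn hi.integrableOn (b := x)]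
    ring
  rw [h1]
  exact (hasDerivAt_integral_Iic hc hi x).const_sub _

lemma normalDensity_comm (m s v : ℝ) : normalDensity m s v = normalDensity v s m := by
  rw [normalDensity, normalDensity, ← phi_neg, ← neg_div, neg_sub]

lemma setIntegral_normalDensity_Ioi (m : ℝ) {s : ℝ} (hs : 0 < s) (c : ℝ) :
    ∫ t in Ioi c, normalDensity m s t = Phi ((m - c) / s) := by
  have h1 : ∫ t in Iic c, normalDensity m s t = Phi ((c - m) / s) := by
    rw [← normalLaw_real_Iic m hs, ← integral_indicator_one measurableSet_Iic,
      integral_normalLaw m hs, ← integral_indicator measurableSet_Iic]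
    congr 1; ext v
    by_cases h : v ∈ Iic c <;> simp [h]
  have hi := integrable_normalDensity m hs
  have h2 := intervalIntegral.integral_Iic_add_Ioi hi.integrableOn hi.integrableOn (b := c)
  rw [integral_normalDensity m hs, h1] at h2
  rw [show (m - c) / s = -((c - m) / s) by ring, Phi_neg]
  linarith

end HalfLine

/-! ### Bayes' rule and the derivatives of expected sales and beliefs. -/

namespace Market

variable (M : Market)

/-- Bayes' rule: both sides are the joint density of quality and valuation, factored in the two
orders. -/
lemma normalDensity_mul_normalDensity (t v : ℝ) :
    normalDensity M.θ M.σθ v * normalDensity v M.σε t =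
      normalDensity M.θ M.σ t * normalDensity (M.μ t) M.σv v := by
  have h1 := M.σ_pos; have h2 := M.σθ_pos; have h3 := M.σε_pos
  simp only [normalDensity, phi_eq, σv_eq]
  rw [show ∀ a b c d e : ℝ, a * b / c * (a * d / e) = a * a / (c * e) * (b * d) by
    intros; ring]
  rw [show ∀ a b c d e : ℝ, a * b / c * (a * d / e) = a * a / (c * e) * (b * d) by
    intros; ring]
  rw [← Real.exp_add, ← Real.exp_add]
  have hsq := M.σ_sq
  have hμ : M.μ t = (M.σθ ^ 2 * t + M.σε ^ 2 * M.θ) / M.σ ^ 2 := by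
    rw [μ, one_sub_τ_eq, τ_eq]; ring
  congr 2
  · field_simp
  · rw [hμ]
    field_simp
    rw [hsq]
    ring

lemma sales_eq_integral (c v : ℝ) : M.sales c v = ∫ t in Ioi c, normalDensity v M.σε t := by
  rw [setIntegral_normalDensity_Ioi _ M.σε_pos, sales]

lemma integrable_joint_density (c : ℝ) :
    Integrable (fun q : ℝ × ℝ => normalDensity M.θ M.σθ q.1 * normalDensity q.1 M.σε q.2)
      (volume.prod (volume.restrict (Ioi c))) := by
  have hcont : Continuous
      (fun q : ℝ × ℝ => normalDensity M.θ M.σθ q.1 * normalDensity q.1 M.σε q.2) := by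
    refine ((continuous_normalDensity _ _).comp continuous_fst).mul ?_
    unfold normalDensity
    exact (continuous_phi.comp (by fun_prop)).div_const _
  refine (integrable_prod_iff hcont.aestronglyMeasurable).2 ⟨ae_of_all _ fun v => ?_, ?_⟩
  · exact ((integrable_normalDensity v M.σε_pos).const_mul (normalDensity M.θ M.σθ v)).restrict
  · have h : ∀ v, ∫ t in Ioi c, ‖normalDensity M.θ M.σθ v * normalDensity v M.σε t‖ =
        normalDensity M.θ M.σθ v * M.sales c v := fun v => by
      rw [sales_eq_integral, ← integral_const_mul]
      refine integral_congr_ae (ae_of_all _ fun t => ?_)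
      exact Real.norm_of_nonneg
        (mul_pos (normalDensity_pos _ M.σθ_pos _) (normalDensity_pos _ M.σε_pos _)).le
    simp only [h]
    exact integrable_normalDensity_mul _ M.σθ_pos (M.continuous_sales c).measurable
      (M.sales_mem_Icc c)

/-- Sales are the mass of valuations above c; Fubini and Bayes' rule exchange the order of
conditioning. -/
lemma integral_mul_sales {g : ℝ → ℝ} (hg : Measurable g) {a b : ℝ} (hb : ∀ v, g v ∈ Icc a b)
    (c : ℝ) : ∫ v, g v * M.sales c v ∂(normalLaw M.θ M.σθ) =
      ∫ t in Ioi c, normalDensity M.θ M.σ t * M.expectedReward g t := by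
  have hint : Integrable (fun q : ℝ × ℝ =>
      normalDensity M.θ M.σθ q.1 * normalDensity q.1 M.σε q.2 * g q.1)
      (volume.prod (volume.restrict (Ioi c))) := by
    refine (M.integrable_joint_density c).mul_bdd (c := max |a| |b|)
      (hg.comp measurable_fst).aestronglyMeasurable (ae_of_all _ fun q => ?_)
    exact abs_le_max_abs_abs (hb q.1).1 (hb q.1).2
  have h1 : ∀ v, normalDensity M.θ M.σθ v * (g v * M.sales c v) =
      ∫ t in Ioi c, normalDensity M.θ M.σθ v * normalDensity v M.σε t * g v := fun v => by
    rw [integral_mul_const, integral_const_mul, ← sales_eq_integral]; ring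
  rw [integral_normalLaw _ M.σθ_pos]
  simp only [h1]
  rw [integral_integral_swap hint]
  refine integral_congr_ae (ae_of_all _ fun t => ?_)
  simp only [M.normalDensity_mul_normalDensity]
  rw [expectedReward, posterior, integral_normalLaw _ M.σv_pos, ← integral_const_mul]
  simp only [mul_assoc]

/-- Expected sales volume if exactly the consumers with valuation above `c` buy. -/
noncomputable def meanSales (c : ℝ) : ℝ := Phi ((M.θ - c) / M.σ)

/-- Expected sales volume on the event that the quality is at most `v`. -/
noncomputable def salesBelow (c v : ℝ) : ℝ :=
  ∫ u in Iic v, normalDensity M.θ M.σθ u * M.sales c u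

/-- Probability that a consumer with valuation `c` assigns to a quality of at most `v`. -/
noncomputable def beliefBelow (c v : ℝ) : ℝ := Phi ((v - M.μ c) / M.σv)

lemma integral_sales (c : ℝ) :
    ∫ v, M.sales c v ∂(normalLaw M.θ M.σθ) = M.meanSales c := by
  have := M.integral_mul_sales (g := fun _ => 1) measurable_const (a := 0) (b := 1) (by simp) c
  simp only [one_mul] at this
  rw [this, meanSales, ← setIntegral_normalDensity_Ioi _ M.σ_pos]
  simp [expectedReward]

lemma expectedReward_indicator_one (t v : ℝ) :
    M.expectedReward ((Iic v).indicator fun _ => 1) t = M.beliefBelow t v := by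
  rw [expectedReward, integral_indicator_const _ measurableSet_Iic, posterior,
    normalLaw_real_Iic _ M.σv_pos]
  simp [beliefBelow]

lemma indicator_one_mem_Icc (v u : ℝ) :
    (Iic v).indicator (fun _ : ℝ => (1 : ℝ)) u ∈ Icc (0 : ℝ) 1 := by
  by_cases h : u ∈ Iic v <;> simp [h]

lemma measurable_indicator_one (v : ℝ) : Measurable ((Iic v).indicator fun _ : ℝ => (1 : ℝ)) :=
  measurable_const.indicator measurableSet_Iic

lemma integral_indicator_mul_sales (c v : ℝ) :
    ∫ u, (Iic v).indicator (fun _ => (1 : ℝ)) u * M.sales c u ∂(normalLaw M.θ M.σθ) =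
      M.salesBelow c v := by
  rw [integral_normalLaw _ M.σθ_pos, salesBelow, ← integral_indicator measurableSet_Iic]
  congr 1; ext u
  by_cases h : u ∈ Iic v <;> simp [h]

lemma salesBelow_eq_integral_Ioi (c v : ℝ) :
    M.salesBelow c v = ∫ t in Ioi c, normalDensity M.θ M.σ t * M.beliefBelow t v := by
  rw [← integral_indicator_mul_sales,
    M.integral_mul_sales (measurable_indicator_one v) (indicator_one_mem_Icc v)]
  simp only [expectedReward_indicator_one]

lemma continuous_μ : Continuous M.μ := by unfold μ; fun_prop

lemma continuous_beliefBelow : Continuous fun q : ℝ × ℝ => M.beliefBelow q.1 q.2 := by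
  have := M.continuous_μ
  unfold beliefBelow
  exact continuous_Phi.comp (by fun_prop)

lemma hasDerivAt_μ (c : ℝ) : HasDerivAt M.μ M.τ c := by
  unfold μ
  exact (((hasDerivAt_id c).const_mul M.τ).add_const _).congr_deriv (by simp)

lemma hasDerivAt_beliefBelow_left (c v : ℝ) :
    HasDerivAt (fun c => M.beliefBelow c v) (-(M.τ * normalDensity (M.μ c) M.σv v)) c := by
  have h := (hasDerivAt_Phi ((v - M.μ c) / M.σv)).comp c
    (((M.hasDerivAt_μ c).const_sub v).div_const M.σv)
  exact h.congr_deriv (by rw [normalDensity]; ring)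

lemma hasDerivAt_beliefBelow_right (c v : ℝ) :
    HasDerivAt (fun v => M.beliefBelow c v) (normalDensity (M.μ c) M.σv v) v := by
  have h := (hasDerivAt_Phi ((v - M.μ c) / M.σv)).comp v
    (((hasDerivAt_id v).sub_const (M.μ c)).div_const M.σv)
  exact h.congr_deriv (by rw [normalDensity]; ring)

lemma hasDerivAt_meanSales (c : ℝ) :
    HasDerivAt M.meanSales (-normalDensity M.θ M.σ c) c := by
  have h := (hasDerivAt_Phi ((M.θ - c) / M.σ)).comp c
    (((hasDerivAt_id c).const_sub M.θ).div_const M.σ)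
  refine h.congr_deriv ?_
  rw [normalDensity_comm, normalDensity]; ring

lemma hasDerivAt_salesBelow_left (c v : ℝ) :
    HasDerivAt (fun c => M.salesBelow c v) (-(normalDensity M.θ M.σ c * M.beliefBelow c v)) c := by
  -- In this form c enters only as the endpoint of integration.
  simp only [salesBelow_eq_integral_Ioi]
  have hc : Continuous fun t => M.beliefBelow t v :=
    M.continuous_beliefBelow.comp (by fun_prop : Continuous fun t => (t, v))
  exact hasDerivAt_integral_Ioi ((continuous_normalDensity _ _).mul hc)
    (integrable_normalDensity_mul _ M.σ_pos hc.measurable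
      (fun t => ⟨(Phi_pos _).le, (Phi_lt_one _).le⟩)) c

lemma hasDerivAt_salesBelow_right (c v : ℝ) :
    HasDerivAt (fun v => M.salesBelow c v) (normalDensity M.θ M.σθ v * M.sales c v) v :=
  hasDerivAt_integral_Iic ((continuous_normalDensity _ _).mul (M.continuous_sales c))
    (integrable_normalDensity_mul _ M.σθ_pos (M.continuous_sales c).measurable
      (M.sales_mem_Icc c)) v

/-- The prior density times the sales volume, in terms of the belief at the cutoff. -/
lemma normalDensity_mul_sales (c v : ℝ) :
    normalDensity M.θ M.σθ v * M.sales c v =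
      M.σε * normalDensity M.θ M.σ c * (normalDensity (M.μ c) M.σv v * mills ((v - c) / M.σε)) := by
  have h3 := M.σε_pos
  have h := M.normalDensity_mul_normalDensity c v
  have h2 : M.sales c v = M.σε * normalDensity v M.σε c * mills ((v - c) / M.σε) := by
    rw [normalDensity_comm, normalDensity, mul_div_cancel₀ _ h3.ne', mul_comm, mills_mul_phi, sales]
  rw [h2]
  linear_combination M.σε * mills ((v - c) / M.σε) * h

end Market

/-! ### Step programs dominate at a given cutoff. -/

namespace Market

variable (M : Market)

/-- Expected profit at the cutoff `c` of a program with a step of size `R` down at quality `v`, when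
the price net of the base reward is the one that makes `c` indifferent. -/
noncomputable def stepProfit (R c v : ℝ) : ℝ :=
  (c + R * M.beliefBelow c v) * M.meanSales c - R * M.salesBelow c v

lemma integrable_mul_sales {g : ℝ → ℝ} (hg : Measurable g) {a b : ℝ} (hb : ∀ v, g v ∈ Icc a b)
    (c : ℝ) (μ : Measure ℝ) [IsFiniteMeasure μ] : Integrable (fun v => g v * M.sales c v) μ := by
  refine (integrable_of_mem_Icc hg hb).mul_bdd (c := 1)
    (M.continuous_sales c).measurable.aestronglyMeasurable (ae_of_all _ fun v => ?_)
  rw [Real.norm_of_nonneg (M.sales_mem_Icc c v).1]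
  exact (M.sales_mem_Icc c v).2

lemma integral_affine_mul_sales (a b c v : ℝ) :
    ∫ u, (a + b * (Iic v).indicator (fun _ => (1 : ℝ)) u) * M.sales c u ∂(normalLaw M.θ M.σθ) =
      a * M.meanSales c + b * M.salesBelow c v := by
  have h1 : Integrable (fun u => a * M.sales c u) (normalLaw M.θ M.σθ) :=
    (integrable_of_mem_Icc (M.continuous_sales c).measurable (M.sales_mem_Icc c)).const_mul a
  have h2 : Integrable (fun u => b * ((Iic v).indicator (fun _ => (1 : ℝ)) u * M.sales c u))
      (normalLaw M.θ M.σθ) :=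
    (M.integrable_mul_sales (measurable_indicator_one v) (indicator_one_mem_Icc v) c _).const_mul b
  simp only [add_mul, mul_assoc]
  rw [integral_add h1 h2, integral_const_mul, integral_const_mul, integral_sales,
    integral_indicator_mul_sales]

lemma profit_of_ae_const {p a : ℝ} {g : ℝ → ℝ} (hg : g =ᵐ[volume] fun _ => a) (c : ℝ) :
    M.profit p g c = (p - a) * M.meanSales c := by
  rw [profit, ← integral_sales, ← integral_const_mul]
  refine integral_congr_ae ?_
  filter_upwards [(normalLaw_ac_volume M.θ M.σθ_pos).ae_le hg] with v hv
  rw [hv]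

lemma ae_eq_const_of_integral_eq {m s a : ℝ} (hs : 0 < s) {g : ℝ → ℝ}
    (hg : Integrable g (normalLaw m s)) (ha : ∀ v, a ≤ g v)
    (h : ∫ v, g v ∂(normalLaw m s) = a) : g =ᵐ[volume] fun _ => a := by
  have h1 : ∫ v, (g v - a) ∂(normalLaw m s) = 0 := by
    rw [integral_sub hg (integrable_const a), h]; simp
  rw [integral_eq_zero_iff_of_nonneg (fun v => sub_nonneg.2 (ha v))
    (hg.sub (integrable_const a))] at h1
  filter_upwards [(volume_ac_normalLaw m hs).ae_le h1] with v hv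
  exact sub_eq_zero.1 hv

/-- Among the programs with values in `[a, a + R]` that make the cutoff `c` indifferent, the step
program has the highest profit, and it is the only one. -/
lemma profit_le_stepProfit {p a R c v : ℝ} {g : ℝ → ℝ} (hg : Measurable g) (hR : 0 < R)
    (hga : ∀ u, g u ∈ Icc a (a + R)) (hind : c + M.expectedReward g c = p)
    (hv : M.expectedReward g c = a + R * M.beliefBelow c v) :
    M.profit p g c ≤ M.stepProfit R c v ∧
      (M.profit p g c = M.stepProfit R c v →
        g =ᵐ[volume] fun u => a + R * (Iic v).indicator (fun _ => (1 : ℝ)) u) := by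
  set w : ℝ → ℝ := fun u => g u - (a + R * (Iic v).indicator (fun _ => (1 : ℝ)) u) with hw
  have hsm : Measurable fun u => a + R * (Iic v).indicator (fun _ => (1 : ℝ)) u :=
    ((measurable_indicator_one v).const_mul R).const_add a
  have hsb : ∀ u, a + R * (Iic v).indicator (fun _ => (1 : ℝ)) u ∈ Icc a (a + R) := fun u => by
    have := indicator_one_mem_Icc v u
    constructor <;> nlinarith [this.1, this.2]
  have hwm : Measurable w := hg.sub hsm
  have hwb : ∀ u, w u ∈ Icc (-R) R := fun u => by
    have h1 := hga u; have h2 := hsb u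
    constructor <;> simp only [hw] <;> linarith [h1.1, h1.2, h2.1, h2.2]
  set k := mills ((v - c) / M.σε) with hk
  set K := M.σε * normalDensity M.θ M.σ c with hK
  have hKpos : 0 < K := mul_pos M.σε_pos (normalDensity_pos _ M.σ_pos _)
  have hdiff : M.stepProfit R c v - M.profit p g c =
      ∫ u, w u * M.sales c u ∂(normalLaw M.θ M.σθ) := by
    have hgi := M.integrable_mul_sales hg hga c (normalLaw M.θ M.σθ)
    have hsi := M.integrable_mul_sales hsm hsb c (normalLaw M.θ M.σθ)
    have hpi := M.integrable_mul_sales (measurable_const (a := p)) (a := p) (b := p) (by simp) c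
      (normalLaw M.θ M.σθ)
    simp only [hw, sub_mul, profit]
    rw [integral_sub hgi hsi, integral_sub hpi hgi, integral_affine_mul_sales,
      integral_const_mul, integral_sales, stepProfit]
    rw [← hind, hv]
    ring
  have hpost : ∫ u, normalDensity (M.μ c) M.σv u * w u = 0 := by
    have hgi : Integrable g (normalLaw (M.μ c) M.σv) := integrable_of_mem_Icc hg hga
    have hii : Integrable ((Iic v).indicator (fun _ => (1 : ℝ))) (normalLaw (M.μ c) M.σv) :=
      integrable_of_mem_Icc (measurable_indicator_one v) (indicator_one_mem_Icc v)
    have hbel := M.expectedReward_indicator_one c v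
    rw [expectedReward, posterior] at hv hbel
    rw [← integral_normalLaw _ M.σv_pos]
    have hsi : Integrable (fun u => a + R * (Iic v).indicator (fun _ => (1 : ℝ)) u)
        (normalLaw (M.μ c) M.σv) := (integrable_const a).add (hii.const_mul R)
    simp only [hw]
    rw [integral_sub hgi hsi, integral_add (integrable_const a) (hii.const_mul R), integral_const_mul, hv, hbel]
    simp
  -- Subtracting a multiple of the indifference condition, whose integral `hpost` vanishes, leaves a
  -- pointwise nonnegative integrand: w and N((u-c)/σε) - k both change sign at v. It vanishes
  -- almost everywhere only if w does.
  set F : ℝ → ℝ := fun u => normalDensity M.θ M.σθ u * (w u * M.sales c u) -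
    k * K * (normalDensity (M.μ c) M.σv u * w u) with hF
  have hFi1 : Integrable fun u => normalDensity M.θ M.σθ u * (w u * M.sales c u) := by
    refine integrable_normalDensity_mul _ M.σθ_pos
      (hwm.mul (M.continuous_sales c).measurable) (a := -R) (b := R) fun u => ?_
    have h1 := hwb u; have h2 := M.sales_mem_Icc c u
    constructor <;> nlinarith [h1.1, h1.2, h2.1, h2.2]
  have hFi2 : Integrable fun u => k * K * (normalDensity (M.μ c) M.σv u * w u) :=
    (integrable_normalDensity_mul _ M.σv_pos hwm hwb).const_mul _
  have hFint : M.stepProfit R c v - M.profit p g c = ∫ u, F u := by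
    rw [hdiff, integral_normalLaw _ M.σθ_pos, hF, integral_sub hFi1 hFi2, integral_const_mul, hpost]
    ring
  have hFeq : ∀ u, F u = K * normalDensity (M.μ c) M.σv u *
      (w u * (mills ((u - c) / M.σε) - k)) := fun u => by
    have := M.normalDensity_mul_sales c u
    simp only [hF]
    linear_combination w u * this
  have hsign : ∀ u, 0 ≤ w u * (mills ((u - c) / M.σε) - k) := fun u => by
    rcases le_or_gt u v with h | h
    · have h1 : mills ((u - c) / M.σε) ≤ k := strictMono_mills.monotone
        (div_le_div_of_nonneg_right (by linarith) M.σε_pos.le)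
      refine mul_nonneg_of_nonpos_of_nonpos ?_ (sub_nonpos.2 h1)
      simp only [hw, indicator_of_mem (mem_Iic.2 h)]
      linarith [(hga u).2]
    · have h1 : k ≤ mills ((u - c) / M.σε) := strictMono_mills.monotone
        (div_le_div_of_nonneg_right (by linarith) M.σε_pos.le)
      refine mul_nonneg ?_ (sub_nonneg.2 h1)
      simp only [hw, indicator_of_notMem (notMem_Iic.2 h)]
      linarith [(hga u).1]
  have hF0 : ∀ u, 0 ≤ F u := fun u => by
    rw [hFeq]
    exact mul_nonneg (mul_pos hKpos (normalDensity_pos _ M.σv_pos _)).le (hsign u)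
  refine ⟨?_, fun heq => ?_⟩
  · have := integral_nonneg (μ := volume) (f := F) hF0
    linarith
  · rw [heq, sub_self, eq_comm, integral_eq_zero_iff_of_nonneg hF0 (hFi1.sub hFi2)] at hFint
    filter_upwards [hFint, compl_mem_ae_iff.2 (measure_singleton v : volume {v} = 0)] with u hu hne
    rw [Pi.zero_apply, hFeq] at hu
    have h1 : mills ((u - c) / M.σε) - k ≠ 0 := by
      rw [sub_ne_zero, hk]
      refine strictMono_mills.injective.ne fun h => hne ?_
      rw [div_left_inj' M.σε_pos.ne'] at h
      simpa using h
    have h2 := (mul_pos hKpos (normalDensity_pos (M.μ c) M.σv_pos u)).ne'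
    have h3 : w u = 0 := by
      rcases mul_eq_zero.1 hu with h | h
      · exact absurd h h2
      · exact (mul_eq_zero.1 h).resolve_right h1
    exact sub_eq_zero.1 h3

lemma rM_pos {p : ℝ} (hp : 0 < p) : 0 < M.rM p := lt_min hp M.spreadBound_pos

/-- A feasible pair either pays a constant, or it is dominated by a step program. -/
lemma Feasible.dichotomy {M : Market} {p : ℝ} (hp : 0 < p) {g : ℝ → ℝ} {c : ℝ}
    (h : M.Feasible p g c) :
    0 ≤ c ∧ c ≤ p ∧ (M.profit p g c = c * M.meanSales c ∨
      ∃ v a, 0 ≤ a ∧ c + M.rM p * M.beliefBelow c v = p - a ∧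
        M.profit p g c ≤ M.stepProfit (M.rM p) c v ∧
        (M.profit p g c = M.stepProfit (M.rM p) c v →
          g =ᵐ[volume] fun u => a + M.rM p * (Iic v).indicator (fun _ => (1 : ℝ)) u)) := by
  obtain ⟨a, ha, haB, ha0⟩ := exists_lower_bound_of_spread h.spread
  have ha0 : 0 ≤ a := ha0 0 fun v => (h.mem_Icc v).1
  set R := M.rM p with hR
  have hRpos : 0 < R := M.rM_pos hp
  -- The upper bound combines g ≤ p ≤ a + p with g ≤ a + B.
  have hgR : ∀ u, g u ∈ Icc a (a + R) := fun u => by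
    refine ⟨ha u, ?_⟩
    rw [hR, rM, ← min_add_add_left]
    exact le_min (by linarith [(h.mem_Icc u).2]) (haB u)
  have hgi : Integrable g (M.posterior c) := integrable_of_mem_Icc h.measurable h.mem_Icc
  have hmean : ∀ b : ℝ, ∫ _, b ∂(M.posterior c) = b := fun b => by simp
  have hI : ∀ b b' : ℝ, (∀ v, g v ∈ Icc b b') → M.expectedReward g c ∈ Icc b b' := fun b b' hb => by
    constructor
    · rw [← hmean b]
      exact integral_mono (integrable_const _) hgi fun v => (hb v).1
    · rw [← hmean b']
      exact integral_mono hgi (integrable_const _) fun v => (hb v).2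
  have hI0 := hI _ _ h.mem_Icc
  have hI1 := hI _ _ hgR
  have hind := h.indifference
  refine ⟨by linarith [hI0.2], by linarith [hI0.1], ?_⟩
  -- An expected reward at an endpoint of [a, a + R] forces g to be constant almost everywhere;
  -- strictly between, a finite step location matches it.
  rcases hI1.1.eq_or_lt with h1 | h1
  · left
    rw [M.profit_of_ae_const (ae_eq_const_of_integral_eq M.σv_pos hgi ha h1.symm)]
    congr 1; linarith
  rcases hI1.2.eq_or_lt with h2 | h2
  · left
    have h3 : (fun v => -g v) =ᵐ[volume] fun _ => -(a + R) := by
      refine ae_eq_const_of_integral_eq (m := M.μ c) M.σv_pos hgi.neg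
        (fun v => neg_le_neg (hgR v).2) ?_
      rw [integral_neg]
      exact congrArg _ h2
    rw [M.profit_of_ae_const (a := a + R) (h3.mono fun v hv => neg_injective hv)]
    congr 1; linarith
  right
  obtain ⟨y, hy⟩ := exists_Phi_eq (g := (M.expectedReward g c - a) / R)
    (div_pos (by linarith) hRpos) ((div_lt_one hRpos).2 (by linarith))
  have hb : M.beliefBelow c (M.μ c + M.σv * y) = (M.expectedReward g c - a) / R := by
    rw [beliefBelow, ← hy]
    congr 1
    have := M.σv_pos
    field_simp
    ring
  have hRb : R * M.beliefBelow c (M.μ c + M.σv * y) = M.expectedReward g c - a := by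
    rw [hb, mul_div_cancel₀ _ hRpos.ne']
  refine ⟨M.μ c + M.σv * y, a, ha0, by linarith, ?_⟩
  exact M.profit_le_stepProfit h.measurable hRpos hgR hind (by linarith)

lemma step_eq (p v u : ℝ) :
    M.step p v u = M.rM p * (Iic v).indicator (fun _ => (1 : ℝ)) u := by
  rw [step]
  by_cases h : u ∈ Iic v <;> simp [h]

lemma measurable_step (p v : ℝ) : Measurable (M.step p v) :=
  measurable_const.indicator measurableSet_Iic

lemma step_mem_Icc {p : ℝ} (hp : 0 < p) (v u : ℝ) : M.step p v u ∈ Icc 0 (M.rM p) := by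
  have h1 := indicator_one_mem_Icc v u
  have h2 := M.rM_pos hp
  rw [step_eq]
  constructor <;> nlinarith [h1.1, h1.2]

lemma expectedReward_step (p v c : ℝ) :
    M.expectedReward (M.step p v) c = M.rM p * M.beliefBelow c v := by
  rw [← expectedReward_indicator_one, expectedReward, expectedReward, ← integral_const_mul]
  simp only [step_eq]

lemma spread_step {p : ℝ} (hp : 0 < p) (v u w : ℝ) :
    M.step p v u - M.step p v w ≤ M.spreadBound := by
  have h1 := (M.step_mem_Icc hp v u).2
  have h2 := (M.step_mem_Icc hp v w).1
  have h3 : M.rM p ≤ M.spreadBound := min_le_right _ _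
  linarith

lemma feasible_step {p : ℝ} (hp : 0 < p) {c v : ℝ} (h : c + M.rM p * M.beliefBelow c v = p) :
    M.Feasible p (M.step p v) c where
  measurable := M.measurable_step p v
  mem_Icc u := ⟨(M.step_mem_Icc hp v u).1, (M.step_mem_Icc hp v u).2.trans (min_le_left _ _)⟩
  spread := M.spread_step hp v
  indifference := by rw [expectedReward_step, h]

lemma profit_step {p c v : ℝ} (h : c + M.rM p * M.beliefBelow c v = p) :
    M.profit p (M.step p v) c = M.stepProfit (M.rM p) c v := by
  have := M.integral_affine_mul_sales p (-M.rM p) c v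
  rw [profit, stepProfit, h, sub_eq_add_neg, ← neg_mul, ← this]
  refine integral_congr_ae (ae_of_all _ fun u => ?_)
  simp only [step_eq]
  ring

end Market

/-! ### Two calculus tools: right-hand increase and differentiability from partial derivatives. -/

section Calculus

lemma eventually_lt_of_hasDerivAt_pos {g : ℝ → ℝ} {g' x : ℝ} (hg : HasDerivAt g g' x)
    (h : 0 < g') : ∀ᶠ y in 𝓝[>] x, g x < g y := by
  have h1 := (hasDerivAt_iff_tendsto_slope.1 hg).mono_left
    (nhdsWithin_mono x fun y (hy : x < y) => hy.ne')
  filter_upwards [h1.eventually (lt_mem_nhds h), self_mem_nhdsWithin] with y hy hxy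
  rw [slope_def_field, lt_div_iff₀ (sub_pos.2 hxy), zero_mul] at hy
  linarith

lemma hasStrictFDerivAt_of_partial {f f₁ f₂ : ℝ → ℝ → ℝ}
    (h₁ : ∀ c v, HasDerivAt (fun c => f c v) (f₁ c v) c)
    (h₂ : ∀ c v, HasDerivAt (fun v => f c v) (f₂ c v) v)
    (hc₁ : Continuous fun q : ℝ × ℝ => f₁ q.1 q.2) (hc₂ : Continuous fun q : ℝ × ℝ => f₂ q.1 q.2)
    (u : ℝ × ℝ) :
    HasStrictFDerivAt (fun q : ℝ × ℝ => f q.1 q.2)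
      ((ContinuousLinearMap.toSpanSingleton ℝ (f₁ u.1 u.2)).coprod
        (ContinuousLinearMap.toSpanSingleton ℝ (f₂ u.1 u.2))) u := by
  have hL : Continuous fun a : ℝ => ContinuousLinearMap.toSpanSingleton ℝ a :=
    (ContinuousLinearMap.toSpanSingletonCLE (𝕜 := ℝ) (E := ℝ)).continuous
  exact hasStrictFDerivAt_uncurry_coprod (u := u) (f := f)
    (f₁ := fun c v => ContinuousLinearMap.toSpanSingleton ℝ (f₁ c v))
    (f₂ := fun c v => ContinuousLinearMap.toSpanSingleton ℝ (f₂ c v))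
    (Eventually.of_forall fun q => (h₁ q.1 q.2).hasFDerivAt)
    (Eventually.of_forall fun q => (h₂ q.1 q.2).hasFDerivAt)
    (hL.comp hc₁).continuousAt (hL.comp hc₂).continuousAt

end Calculus

/-! ### The relaxed problem in the cutoff and the step location. -/

namespace Market

variable (M : Market)

lemma continuous_meanSales : Continuous M.meanSales :=
  continuous_iff_continuousAt.2 fun c => (M.hasDerivAt_meanSales c).continuousAt

lemma meanSales_pos (c : ℝ) : 0 < M.meanSales c := Phi_pos _

lemma meanSales_lt_one (c : ℝ) : M.meanSales c < 1 := Phi_lt_one _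

lemma beliefBelow_pos (c v : ℝ) : 0 < M.beliefBelow c v := Phi_pos _

lemma beliefBelow_lt_one (c v : ℝ) : M.beliefBelow c v < 1 := Phi_lt_one _

lemma antitone_meanSales : Antitone M.meanSales := fun a b h => strictMono_Phi.monotone
  (div_le_div_of_nonneg_right (by linarith) M.σ_pos.le)

lemma strictMono_beliefBelow (c : ℝ) : StrictMono (M.beliefBelow c) := fun a b h =>
  strictMono_Phi (div_lt_div_of_pos_right (by linarith) M.σv_pos)

lemma antitone_beliefBelow (v : ℝ) : Antitone fun c => M.beliefBelow c v := fun a b h => by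
  refine strictMono_Phi.monotone (div_le_div_of_nonneg_right ?_ M.σv_pos.le)
  have := M.μ_sub_μ b a
  have := mul_nonneg M.τ_pos.le (sub_nonneg.2 h)
  linarith

lemma continuous_posteriorDensity :
    Continuous fun q : ℝ × ℝ => normalDensity (M.μ q.1) M.σv q.2 := by
  have := M.continuous_μ
  unfold normalDensity
  exact (continuous_phi.comp (by fun_prop)).div_const _

lemma continuous_sales_uncurry : Continuous fun q : ℝ × ℝ => M.sales q.1 q.2 := by
  unfold sales
  exact continuous_Phi.comp (by fun_prop)

lemma continuous_valuationDensity_mul_beliefBelow :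
    Continuous fun q : ℝ × ℝ => normalDensity M.θ M.σ q.1 * M.beliefBelow q.1 q.2 :=
  ((continuous_normalDensity _ _).comp continuous_fst).mul M.continuous_beliefBelow

lemma continuous_priorDensity_mul_sales :
    Continuous fun q : ℝ × ℝ => normalDensity M.θ M.σθ q.2 * M.sales q.1 q.2 :=
  ((continuous_normalDensity _ _).comp continuous_snd).mul M.continuous_sales_uncurry

lemma continuous_salesBelow : Continuous fun q : ℝ × ℝ => M.salesBelow q.1 q.2 :=
  continuous_iff_continuousAt.2 fun u =>
    (hasStrictFDerivAt_of_partial M.hasDerivAt_salesBelow_left M.hasDerivAt_salesBelow_right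
      M.continuous_valuationDensity_mul_beliefBelow.neg
      M.continuous_priorDensity_mul_sales u).continuousAt

lemma continuous_stepProfit (R : ℝ) : Continuous fun q : ℝ × ℝ => M.stepProfit R q.1 q.2 := by
  have h1 := M.continuous_beliefBelow
  have h2 := M.continuous_salesBelow
  have h3 := M.continuous_meanSales
  unfold stepProfit
  fun_prop

lemma hasDerivAt_stepProfit_left (R c v : ℝ) :
    HasDerivAt (fun c => M.stepProfit R c v)
      ((1 - R * (M.τ * normalDensity (M.μ c) M.σv v)) * M.meanSales c
        - c * normalDensity M.θ M.σ c) c := by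
  have h := ((((hasDerivAt_id c).add ((M.hasDerivAt_beliefBelow_left c v).const_mul R)).mul
    (M.hasDerivAt_meanSales c))).sub ((M.hasDerivAt_salesBelow_left c v).const_mul R)
  exact h.congr_deriv (by simp only [id, Pi.add_apply]; ring)

lemma hasDerivAt_stepProfit_right (R c v : ℝ) :
    HasDerivAt (fun v => M.stepProfit R c v)
      (R * normalDensity (M.μ c) M.σv v * (M.meanSales c -
        M.σε * normalDensity M.θ M.σ c * mills ((v - c) / M.σε))) v := by
  have h := ((((M.hasDerivAt_beliefBelow_right c v).const_mul R).const_add c).mul_const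
    (M.meanSales c)).sub ((M.hasDerivAt_salesBelow_right c v).const_mul R)
  exact h.congr_deriv (by rw [normalDensity_mul_sales]; ring)

lemma salesBelow_nonneg (c v : ℝ) : 0 ≤ M.salesBelow c v :=
  setIntegral_nonneg measurableSet_Iic fun u _ =>
    mul_nonneg (normalDensity_pos _ M.σθ_pos _).le (M.sales_mem_Icc c u).1

/-- On u ≤ v the factor N((u-c)/σε) is at most its value at v. -/
lemma salesBelow_le (c v : ℝ) :
    M.salesBelow c v ≤
      M.σε * normalDensity M.θ M.σ c * mills ((v - c) / M.σε) * M.beliefBelow c v := by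
  have hK : 0 < M.σε * normalDensity M.θ M.σ c := mul_pos M.σε_pos (normalDensity_pos _ M.σ_pos _)
  have hb : M.beliefBelow c v = ∫ u in Iic v, normalDensity (M.μ c) M.σv u := by
    rw [← expectedReward_indicator_one, expectedReward, posterior, integral_normalLaw _ M.σv_pos,
      ← integral_indicator measurableSet_Iic]
    congr 1; ext u
    by_cases h : u ∈ Iic v <;> simp [h]
  rw [hb, salesBelow, ← integral_const_mul]
  refine setIntegral_mono_on ?_ ?_ measurableSet_Iic fun u hu => ?_
  · exact (integrable_normalDensity_mul _ M.σθ_pos (M.continuous_sales c).measurable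
      (M.sales_mem_Icc c)).integrableOn
  · exact ((integrable_normalDensity _ M.σv_pos).const_mul _).integrableOn
  · rw [normalDensity_mul_sales]
    have h1 : mills ((u - c) / M.σε) ≤ mills ((v - c) / M.σε) := strictMono_mills.monotone
      (div_le_div_of_nonneg_right (by linarith [mem_Iic.1 hu]) M.σε_pos.le)
    have h2 := normalDensity_pos (M.μ c) M.σv_pos u
    have h3 := mul_le_mul_of_nonneg_left h1 (mul_pos hK h2).le
    linarith

lemma σε_mul_valuationDensity (c : ℝ) :
    M.σε * normalDensity M.θ M.σ c = M.σε / M.σ * phi ((M.θ - c) / M.σ) := by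
  rw [normalDensity_comm, normalDensity]; ring

lemma σε_lt_σ : M.σε < M.σ := by
  have := M.σ_pos; have := M.σ_sq; have := M.σθ_pos; have := M.σε_pos
  nlinarith

lemma σε_mul_valuationDensity_le_one (c : ℝ) : M.σε * normalDensity M.θ M.σ c ≤ 1 := by
  rw [σε_mul_valuationDensity]
  have h1 : M.σε / M.σ ≤ 1 := (div_le_one M.σ_pos).2 M.σε_lt_σ.le
  have h2 := phi_le_phi_zero ((M.θ - c) / M.σ)
  have h3 := phi_pos ((M.θ - c) / M.σ)
  have h4 := mills_zero_mul_phi_zero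
  have h5 := mills_zero_ge
  have h6 := phi_pos 0
  have h7 : 0 ≤ M.σε / M.σ := (div_pos M.σε_pos M.σ_pos).le
  nlinarith

/-- Controls v → -∞: the gain over the profit without rewards is at most R times a vanishing belief.
-/
lemma stepProfit_le_left {R c v : ℝ} (hR : 0 ≤ R) :
    M.stepProfit R c v ≤ c * M.meanSales c + R * M.beliefBelow c v := by
  have h1 := M.salesBelow_nonneg c v
  have h2 := M.meanSales_lt_one c
  have h3 := M.beliefBelow_pos c v
  have h4 : M.beliefBelow c v * M.meanSales c ≤ M.beliefBelow c v :=
    mul_le_of_le_one_right h3.le h2.le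
  rw [stepProfit]
  nlinarith [mul_le_mul_of_nonneg_left h4 hR, mul_nonneg hR h1]

/-- Controls v → ∞: the gain over the profit without rewards is at most R times the prior
probability of quality above v. -/
lemma stepProfit_le_right {R c v : ℝ} (hR : 0 ≤ R) :
    M.stepProfit R c v ≤ c * M.meanSales c + R * (1 - Phi ((v - M.θ) / M.σθ)) := by
  have h1 : M.meanSales c - M.salesBelow c v ≤ 1 - Phi ((v - M.θ) / M.σθ) := by
    have h2 := M.integral_affine_mul_sales 1 (-1) c v
    have h3 : ∫ u, (1 + -1 * (Iic v).indicator (fun _ => (1 : ℝ)) u) ∂(normalLaw M.θ M.σθ) =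
        1 - Phi ((v - M.θ) / M.σθ) := by
      have hii : Integrable ((Iic v).indicator (fun _ => (1 : ℝ))) (normalLaw M.θ M.σθ) :=
        integrable_of_mem_Icc (measurable_indicator_one v) (indicator_one_mem_Icc v)
      rw [integral_add (integrable_const _) (hii.const_mul _), integral_const_mul,
        integral_indicator_const _ measurableSet_Iic, normalLaw_real_Iic _ M.σθ_pos]
      simp [sub_eq_add_neg]
    have hm : Measurable fun u => 1 + -1 * (Iic v).indicator (fun _ => (1 : ℝ)) u :=
      ((measurable_indicator_one v).const_mul _).const_add _
    have hb : ∀ u, 1 + -1 * (Iic v).indicator (fun _ => (1 : ℝ)) u ∈ Icc (0 : ℝ) 1 := fun u => by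
      have := indicator_one_mem_Icc v u
      constructor <;> linarith [this.1, this.2]
    have h4 := integral_mono (μ := normalLaw M.θ M.σθ) (M.integrable_mul_sales hm hb c _)
      (integrable_of_mem_Icc hm hb)
      fun u => mul_le_of_le_one_right (hb u).1 (M.sales_mem_Icc c u).2
    rw [h2, h3] at h4
    linarith
  have h2 := M.beliefBelow_lt_one c v
  have h3 : M.beliefBelow c v * M.meanSales c ≤ M.meanSales c :=
    mul_le_of_le_one_left (M.meanSales_pos c).le h2.le
  rw [stepProfit]
  nlinarith [mul_le_mul_of_nonneg_left h1 hR, mul_le_mul_of_nonneg_left h3 hR]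

lemma exists_beliefBelow_eq (c : ℝ) {g : ℝ} (h0 : 0 < g) (h1 : g < 1) :
    ∃ v, M.beliefBelow c v = g := by
  obtain ⟨y, hy⟩ := exists_Phi_eq h0 h1
  refine ⟨M.μ c + M.σv * y, ?_⟩
  rw [beliefBelow, ← hy, add_sub_cancel_left, mul_div_cancel_left₀ _ M.σv_pos.ne']

section OptimalPrice

variable {M} {p : ℝ}

lemma IsOptimalPrice.pos (hp : M.IsOptimalPrice p) : 0 < p := by
  have h := hp 1
  have h1 := Phi_pos ((M.θ - 1) / M.σ)
  have h2 := Phi_pos ((M.θ - p) / M.σ)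
  rw [one_mul] at h
  exact pos_of_mul_pos_left (h1.trans_le h) h2.le

lemma IsOptimalPrice.le (hp : M.IsOptimalPrice p) (c : ℝ) :
    c * M.meanSales c ≤ p * M.meanSales p := hp c

lemma hasDerivAt_mul_meanSales (c : ℝ) : HasDerivAt (fun c => c * M.meanSales c)
    (M.meanSales c - c * normalDensity M.θ M.σ c) c :=
  ((hasDerivAt_id c).mul (M.hasDerivAt_meanSales c)).congr_deriv (by simp; ring)

lemma IsOptimalPrice.meanSales_eq (hp : M.IsOptimalPrice p) :
    M.meanSales p = p * normalDensity M.θ M.σ p := by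
  have h : IsLocalMax (fun c => c * M.meanSales c) p := Eventually.of_forall hp.le
  have := h.hasDerivAt_eq_zero (hasDerivAt_mul_meanSales p)
  linarith

lemma IsOptimalPrice.mills_eq (hp : M.IsOptimalPrice p) :
    mills ((M.θ - p) / M.σ) = p / M.σ := by
  have h := hp.meanSales_eq
  have hφ := phi_pos ((M.θ - p) / M.σ)
  have hσ := M.σ_pos
  rw [normalDensity_comm, normalDensity, meanSales] at h
  rw [mills, h]
  field_simp

/-- A small reward at low qualities is profitable. -/
lemma IsOptimalPrice.exists_stepProfit_gt (hp : M.IsOptimalPrice p) {R : ℝ} (hR : 0 < R) :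
    ∃ c v, 0 ≤ c ∧ c + R * M.beliefBelow c v ≤ p ∧ p * M.meanSales p < M.stepProfit R c v := by
  have hp0 := hp.pos
  have hQ := M.meanSales_pos p
  -- Low enough qualities make a unit of expected reward cost at most half of `meanSales p`.
  obtain ⟨w, hw⟩ : ∃ w, mills w < M.meanSales p / 2 :=
    (tendsto_mills_atBot.eventually (gt_mem_nhds (by positivity))).exists
  set vs := M.σε * w with hvs
  -- Lowering the cutoff by δ loses nothing to first order because p is optimal, while the net gain
  -- from rewards is of order δ.
  have hd : HasDerivAt (fun δ => (p - δ) * M.meanSales (p - δ) + δ * (M.meanSales p / 2))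
      (M.meanSales p / 2) 0 := by
    have h1 := hasDerivAt_mul_meanSales (M := M) (p - 0)
    have h2 := h1.comp (0 : ℝ) ((hasDerivAt_id (0 : ℝ)).const_sub p)
    refine (h2.add ((hasDerivAt_id (0 : ℝ)).mul_const (M.meanSales p / 2))).congr_deriv ?_
    rw [sub_zero, ← hp.meanSales_eq]
    simp
  have hev := eventually_lt_of_hasDerivAt_pos hd (by positivity)
  have hRG : 0 < R * M.beliefBelow p vs := mul_pos hR (M.beliefBelow_pos _ _)
  obtain ⟨δ, hδ, hδ0, hδp, hδR⟩ := (hev.and (eventually_mem_nhdsWithin.and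
    (((gt_mem_nhds hp0).filter_mono nhdsWithin_le_nhds).and
      ((gt_mem_nhds hRG).filter_mono nhdsWithin_le_nhds)))).exists
  have hδ0 : 0 < δ := hδ0
  simp only [sub_zero, zero_mul, add_zero] at hδ
  have hlt : δ / R < M.beliefBelow p vs := by rwa [div_lt_iff₀ hR, mul_comm]
  obtain ⟨v, hv⟩ := M.exists_beliefBelow_eq (p - δ) (div_pos hδ0 hR)
    (hlt.trans (M.beliefBelow_lt_one _ _))
  have hvv : v < vs := by
    rw [← (M.strictMono_beliefBelow (p - δ)).lt_iff_lt, hv]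
    exact hlt.trans_le (M.antitone_beliefBelow vs (by linarith))
  have hRv : R * M.beliefBelow (p - δ) v = δ := by rw [hv, mul_div_cancel₀ _ hR.ne']
  refine ⟨p - δ, v, by linarith, by linarith, hδ.trans_le ?_⟩
  have hL := M.salesBelow_le (p - δ) v
  have hm : mills ((v - (p - δ)) / M.σε) ≤ M.meanSales p / 2 := by
    refine le_trans (strictMono_mills.monotone ?_) hw.le
    rw [div_le_iff₀ M.σε_pos]
    linarith [mul_comm w M.σε]
  have hK := M.σε_mul_valuationDensity_le_one (p - δ)
  have hK0 : 0 < M.σε * normalDensity M.θ M.σ (p - δ) :=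
    mul_pos M.σε_pos (normalDensity_pos _ M.σ_pos _)
  have hG := M.beliefBelow_pos (p - δ) v
  have hL2 : M.salesBelow (p - δ) v ≤ M.meanSales p / 2 * M.beliefBelow (p - δ) v := by
    refine hL.trans (mul_le_mul_of_nonneg_right ?_ hG.le)
    have := mills_pos ((v - (p - δ)) / M.σε)
    nlinarith
  have hRL : R * M.salesBelow (p - δ) v ≤ M.meanSales p / 2 * δ := by
    have := mul_le_mul_of_nonneg_left hL2 hR.le
    linear_combination this + M.meanSales p / 2 * hRv
  have hQδ : M.meanSales p ≤ M.meanSales (p - δ) := M.antitone_meanSales (by linarith)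
  rw [stepProfit, hRv]
  nlinarith

/-- Existence of an optimal cutoff and step. -/
lemma IsOptimalPrice.exists_stepProfit_max (hp : M.IsOptimalPrice p) {R : ℝ} (hR : 0 < R) :
    ∃ c v, 0 ≤ c ∧ c + R * M.beliefBelow c v ≤ p ∧ p * M.meanSales p < M.stepProfit R c v ∧
      ∀ d w, 0 ≤ d → d + R * M.beliefBelow d w ≤ p → M.stepProfit R d w ≤ M.stepProfit R c v := by
  obtain ⟨c₁, v₁, hc₁, hP₁, hV⟩ := hp.exists_stepProfit_gt hR
  set ε := (M.stepProfit R c₁ v₁ - p * M.meanSales p) / R with hε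
  have hε0 : 0 < ε := div_pos (sub_pos.2 hV) hR
  have hεR : R * ε = M.stepProfit R c₁ v₁ - p * M.meanSales p := mul_div_cancel₀ _ hR.ne'
  obtain ⟨lo, hlo⟩ : ∃ lo, M.beliefBelow 0 lo < ε := by
    obtain ⟨y, hy⟩ := (tendsto_Phi_atBot.eventually (gt_mem_nhds hε0)).exists
    exact ⟨M.μ 0 + M.σv * y, by
      rwa [beliefBelow, add_sub_cancel_left, mul_div_cancel_left₀ _ M.σv_pos.ne']⟩
  obtain ⟨hi, hhi⟩ : ∃ hi, 1 - Phi ((hi - M.θ) / M.σθ) < ε := by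
    obtain ⟨y, hy⟩ := (tendsto_Phi_atTop.eventually
      (lt_mem_nhds (show 1 - ε < 1 by linarith))).exists
    exact ⟨M.θ + M.σθ * y, by
      rw [add_sub_cancel_left, mul_div_cancel_left₀ _ M.σθ_pos.ne']; linarith⟩
  -- Outside [lo, hi] the gain over p·`meanSales p` would be below Rε, the gain already achieved at
  -- (c₁, v₁).
  have hbound : ∀ d w, 0 ≤ d → M.stepProfit R c₁ v₁ ≤ M.stepProfit R d w → w ∈ Icc lo hi := by
    intro d w hd hdw
    have hle := hp.le d
    constructor
    · by_contra! h
      have h1 := M.stepProfit_le_left (c := d) (v := w) hR.le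
      have h2 : M.beliefBelow d w ≤ M.beliefBelow 0 w := M.antitone_beliefBelow w hd
      have h3 := M.strictMono_beliefBelow 0 h
      nlinarith
    · by_contra! h
      have h1 := M.stepProfit_le_right (c := d) (v := w) hR.le
      have h2 : Phi ((hi - M.θ) / M.σθ) ≤ Phi ((w - M.θ) / M.σθ) :=
        strictMono_Phi.monotone (div_le_div_of_nonneg_right (by linarith) M.σθ_pos.le)
      nlinarith
  set K : Set (ℝ × ℝ) := (Icc 0 p ×ˢ Icc lo hi) ∩ {q | q.1 + R * M.beliefBelow q.1 q.2 ≤ p} with hK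
  have hKc : IsCompact K := by
    refine (isCompact_Icc.prod isCompact_Icc).inter_right (isClosed_le ?_ continuous_const)
    exact continuous_fst.add (M.continuous_beliefBelow.const_mul R)
  have hmemK : ∀ d w, 0 ≤ d → d + R * M.beliefBelow d w ≤ p → w ∈ Icc lo hi → (d, w) ∈ K :=
    fun d w hd hP hw => by
      have := mul_pos hR (M.beliefBelow_pos d w)
      exact ⟨⟨⟨hd, by linarith⟩, hw⟩, hP⟩
  have h1K : (c₁, v₁) ∈ K := hmemK _ _ hc₁ hP₁ (hbound _ _ hc₁ le_rfl)
  obtain ⟨⟨c, v⟩, hcv, hmax⟩ := hKc.exists_isMaxOn ⟨_, h1K⟩ (M.continuous_stepProfit R).continuousOn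
  have h1 : M.stepProfit R c₁ v₁ ≤ M.stepProfit R c v := hmax h1K
  refine ⟨c, v, hcv.1.1.1, hcv.2, hV.trans_le h1, fun d w hd hP => ?_⟩
  rcases le_total (M.stepProfit R d w) (M.stepProfit R c₁ v₁) with h | h
  · exact h.trans h1
  · exact hmax (hmemK d w hd hP (hbound d w hd h))

lemma mul_τ_mul_density (R c v : ℝ) :
    R * (M.τ * normalDensity (M.μ c) M.σv v) =
      R / M.spreadBound * Real.exp (-((v - M.μ c) / M.σv) ^ 2 / 2) := by
  have h := M.spreadBound_mul_τ_mul_phi_zero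
  have h1 := M.spreadBound_pos
  have h2 := M.σv_pos
  rw [normalDensity, phi_eq_zero_mul]
  field_simp
  linear_combination R * h

/-- At a point where the step is optimal for a given cutoff, a higher cutoff increases the profit as
long as the net price is below the optimal one. -/
lemma IsOptimalPrice.stepProfit_deriv_pos (hp : M.IsOptimalPrice p) {R c v : ℝ} (hR : 0 < R)
    (hRB : R ≤ M.spreadBound) (hP : c + R * M.beliefBelow c v ≤ p)
    (hv : M.meanSales c = M.σε * normalDensity M.θ M.σ c * mills ((v - c) / M.σε)) :
    0 < (1 - R * (M.τ * normalDensity (M.μ c) M.σv v)) * M.meanSales c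
      - c * normalDensity M.θ M.σ c := by
  have hσ := M.σ_pos; have hθ := M.σθ_pos; have hε := M.σε_pos; have hB := M.spreadBound_pos
  have hφ := phi_pos ((M.θ - c) / M.σ)
  have hsq := M.σ_sq
  have hσv := M.σv_pos
  have key := mills_sub_sub_lt_of_le (s := M.σε / M.σ) (κ := M.σθ / M.σ)
    (x := (v - c) / M.σε) (y := (v - M.μ c) / M.σv) (z := (M.θ - c) / M.σ)
    (div_pos hε hσ) (div_pos hθ hσ) (by field_simp; linarith) ?_ ?_
    (ρ := R / M.spreadBound) (d := (p - c) / M.σ) (div_pos hR hB) ((div_le_one hB).2 hRB) ?_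
  -- Optimality of p turns N(z - d) - d, with d = (p - c)/σ, into c/σ.
  · rw [← sub_div, sub_sub_sub_cancel_right, hp.mills_eq, ← sub_div, sub_sub_cancel,
      ← mul_τ_mul_density] at key
    have h1 := mul_lt_mul_of_pos_right key hφ
    rw [mul_right_comm, mills_mul_phi] at h1
    have h2 : c * normalDensity M.θ M.σ c = c / M.σ * phi ((M.θ - c) / M.σ) := by
      rw [normalDensity_comm, normalDensity]; ring
    rw [h2, meanSales]
    linarith
  · have hμ : M.μ c = (M.σθ ^ 2 * c + M.σε ^ 2 * M.θ) / M.σ ^ 2 := by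
      rw [μ, one_sub_τ_eq, τ_eq]; ring
    rw [hμ, σv_eq]
    field_simp
    rw [hsq]
    ring
  · rw [σε_mul_valuationDensity, meanSales, ← mills_mul_phi] at hv
    have h1 : mills ((M.θ - c) / M.σ) * phi ((M.θ - c) / M.σ) =
        M.σε / M.σ * mills ((v - c) / M.σε) * phi ((M.θ - c) / M.σ) := by rw [hv]; ring
    exact (mul_right_cancel₀ hφ.ne' h1).symm
  · have h0 := mills_zero_mul_phi_zero
    have hφ0 := phi_pos 0
    have hm0 : 2 * mills 0 = √(2 * Real.pi) := by
      rw [phi_zero] at h0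
      exact (mul_inv_eq_one₀ (by positivity)).1 h0
    have hpi : (0 : ℝ) < √(2 * Real.pi) := by positivity
    have h1 : R / M.spreadBound * (2 * mills 0 * (M.σε / M.σ / (M.σθ / M.σ)) *
        Phi ((v - M.μ c) / M.σv)) = R * M.beliefBelow c v / M.σ := by
      rw [hm0, spreadBound, beliefBelow]
      field_simp
    rw [h1]
    gcongr
    linarith

/-- At the maximum, the price constraint binds. -/
lemma IsOptimalPrice.binding (hp : M.IsOptimalPrice p) {R c v : ℝ} (hR : 0 < R)
    (hRB : R ≤ M.spreadBound) (hc : 0 ≤ c) (hP : c + R * M.beliefBelow c v ≤ p)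
    (hmax : ∀ d w, 0 ≤ d → d + R * M.beliefBelow d w ≤ p →
      M.stepProfit R d w ≤ M.stepProfit R c v) :
    c + R * M.beliefBelow c v = p := by
  by_contra hne
  have hlt : c + R * M.beliefBelow c v < p := lt_of_le_of_ne hP hne
  have hbr : Continuous fun w => M.beliefBelow c w :=
    M.continuous_beliefBelow.comp (by fun_prop : Continuous fun w => (c, w))
  have hbl : Continuous fun d => M.beliefBelow d v :=
    M.continuous_beliefBelow.comp (by fun_prop : Continuous fun d => (d, v))
  -- Slackness of the price constraint makes v an unconstrained local maximizer.
  have hlm : IsLocalMax (fun w => M.stepProfit R c w) v := by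
    have hcont : Continuous fun w => c + R * M.beliefBelow c w := by fun_prop
    filter_upwards [hcont.continuousAt.eventually (gt_mem_nhds hlt)] with w hw
    exact hmax c w hc hw.le
  have hzero := hlm.hasDerivAt_eq_zero (M.hasDerivAt_stepProfit_right R c v)
  have hpos := mul_pos hR (normalDensity_pos (M.μ c) M.σv_pos v)
  have hQ := sub_eq_zero.1 ((mul_eq_zero.1 hzero).resolve_left hpos.ne')
  have hd := hp.stepProfit_deriv_pos hR hRB hP hQ
  have hev := eventually_lt_of_hasDerivAt_pos (M.hasDerivAt_stepProfit_left R c v) hd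
  have hcont : Continuous fun d => d + R * M.beliefBelow d v := by fun_prop
  have hnear := (hcont.continuousAt.eventually (gt_mem_nhds hlt)).filter_mono
    (nhdsWithin_le_nhds (s := Ioi c))
  obtain ⟨d, hd1, hd2, hd3⟩ := (hev.and (eventually_mem_nhdsWithin.and hnear)).exists
  have hd2 : c < d := hd2
  exact absurd (hmax d v (by linarith) (le_of_lt hd3)) (not_le.2 hd1)

/-- The first-order condition at the maximum. -/
lemma solvesSystem_of_max {c v : ℝ} (hp : 0 < p) (hc : 0 ≤ c)
    (hP : c + M.rM p * M.beliefBelow c v = p)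
    (hmax : ∀ d w, 0 ≤ d → d + M.rM p * M.beliefBelow d w ≤ p →
      M.stepProfit (M.rM p) d w ≤ M.stepProfit (M.rM p) c v) :
    M.SolvesSystem p c v := by
  set R := M.rM p with hR
  have hRpos : 0 < R := M.rM_pos hp
  have hRp : R ≤ p := min_le_left _ _
  have hG0 := M.beliefBelow_pos c v
  have hG1 := M.beliefBelow_lt_one c v
  -- Strict positivity keeps c ≥ 0 inactive, so that only the price equation needs a multiplier.
  have hc0 : 0 < c := by
    refine lt_of_le_of_ne hc fun h => ?_
    rw [← h, zero_add] at hP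
    rw [← h] at hG1
    nlinarith
  have hg := normalDensity_pos (M.μ c) M.σv_pos v
  have hfX := normalDensity_pos M.θ M.σ_pos c
  have hε := M.σε_pos
  have hcon := hasStrictFDerivAt_of_partial
    (f := fun c v => c + R * M.beliefBelow c v)
    (f₁ := fun c v => 1 + R * -(M.τ * normalDensity (M.μ c) M.σv v))
    (f₂ := fun c v => R * normalDensity (M.μ c) M.σv v)
    (fun c v => (hasDerivAt_id c).add ((M.hasDerivAt_beliefBelow_left c v).const_mul R))
    (fun c v => ((M.hasDerivAt_beliefBelow_right c v).const_mul R).const_add c)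
    (((M.continuous_posteriorDensity.const_mul M.τ).neg.const_mul R).const_add 1)
    (M.continuous_posteriorDensity.const_mul R) (c, v)
  -- On the constraint curve the net price is p, so this simpler objective agrees there with
  -- `stepProfit`.
  have hobj := hasStrictFDerivAt_of_partial
    (f := fun c v => p * M.meanSales c - R * M.salesBelow c v)
    (f₁ := fun c v => p * -normalDensity M.θ M.σ c -
      R * -(normalDensity M.θ M.σ c * M.beliefBelow c v))
    (f₂ := fun c v => -(R * (normalDensity M.θ M.σθ v * M.sales c v)))
    (fun c v => ((M.hasDerivAt_meanSales c).const_mul p).sub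
      ((M.hasDerivAt_salesBelow_left c v).const_mul R))
    (fun c v => ((M.hasDerivAt_salesBelow_right c v).const_mul R).const_sub _)
    ((((continuous_normalDensity M.θ M.σ).comp continuous_fst).neg.const_mul p).sub
      (M.continuous_valuationDensity_mul_beliefBelow.neg.const_mul R))
    (M.continuous_priorDensity_mul_sales.const_mul R).neg (c, v)
  have hextr : IsLocalExtrOn (fun q : ℝ × ℝ => p * M.meanSales q.1 - R * M.salesBelow q.1 q.2)
      {q : ℝ × ℝ | q.1 + R * M.beliefBelow q.1 q.2 = c + R * M.beliefBelow c v} (c, v) := by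
    refine Or.inr ?_
    have hnear : ∀ᶠ q : ℝ × ℝ in 𝓝 (c, v), 0 < q.1 :=
      continuous_fst.continuousAt.eventually (lt_mem_nhds hc0)
    filter_upwards [mem_nhdsWithin_of_mem_nhds hnear, self_mem_nhdsWithin] with q hq hq2
    have hq2 : q.1 + R * M.beliefBelow q.1 q.2 = c + R * M.beliefBelow c v := hq2
    rw [hP] at hq2
    have := hmax q.1 q.2 (le_of_lt hq) hq2.le
    rwa [stepProfit, stepProfit, hq2, hP] at this
  obtain ⟨a, b, hab, hsum⟩ := hextr.exists_multipliers_of_hasStrictFDerivAt_1d hcon hobj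
  set g := normalDensity (M.μ c) M.σv v with hg_def
  set m := mills ((v - c) / M.σε) with hm_def
  set f := normalDensity M.θ M.σ c with hf_def
  have hm : 0 < m := mills_pos _
  have e1 : a * (1 - R * (M.τ * g)) = b * (f * c) := by
    have h : a * (1 + R * -(M.τ * g)) + b * (p * -f - R * -(f * M.beliefBelow c v)) = 0 := by
      simpa using congrArg (fun L : ℝ × ℝ →L[ℝ] ℝ => L (1, 0)) hsum
    linear_combination h - b * f * hP
  have e2 : a = b * (M.σε * f * m) := by
    have h : a * (R * g) + b * -(R * (normalDensity M.θ M.σθ v * M.sales c v)) = 0 := by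
      simpa using congrArg (fun L : ℝ × ℝ →L[ℝ] ℝ => L (0, 1)) hsum
    rw [normalDensity_mul_sales] at h
    refine mul_right_cancel₀ (mul_pos hRpos hg).ne' ?_
    linear_combination h
  have hb : b ≠ 0 := by
    rintro rfl
    rw [zero_mul] at e2
    exact hab (by rw [e2]; rfl)
  have hfoc : M.σε * m * (1 - R * (M.τ * g)) = c := by
    refine mul_left_cancel₀ (mul_ne_zero hb hfX.ne') ?_
    linear_combination e1 - (1 - R * (M.τ * g)) * e2
  have hne : 1 - R * (M.τ * g) ≠ 0 := fun h => by
    rw [h, mul_zero] at hfoc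
    exact hc0.ne hfoc
  refine ⟨hP.symm, ?_⟩
  have h1 : 1 - M.τ * M.rM p * (phi ((v - M.μ c) / M.σv) / M.σv) = 1 - R * (M.τ * g) := by
    rw [hg_def, normalDensity]; ring
  rw [h1, eq_div_iff hne, div_div_eq_mul_div, mul_div_right_comm, ← mills, ← hm_def]
  linear_combination hfoc

end OptimalPrice

end Market

/-! ### Optimal programs and uniqueness of the cutoff. -/

namespace Market

variable {M : Market} {p : ℝ}

lemma IsOptimalPrice.profit_le (hp : M.IsOptimalPrice p) {c v : ℝ}
    (hgt : p * M.meanSales p < M.stepProfit (M.rM p) c v)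
    (hmax : ∀ d w, 0 ≤ d → d + M.rM p * M.beliefBelow d w ≤ p →
      M.stepProfit (M.rM p) d w ≤ M.stepProfit (M.rM p) c v)
    {g : ℝ → ℝ} {d : ℝ} (h : M.Feasible p g d) :
    M.profit p g d ≤ M.stepProfit (M.rM p) c v := by
  obtain ⟨hd, -, h1 | ⟨w, a, ha, hw, hle, -⟩⟩ := h.dichotomy hp.pos
  · rw [h1]
    exact (hp.le d).trans hgt.le
  · exact hle.trans (hmax d w hd (by linarith))

/-- The optimal programs are single steps that solve the first-order conditions. -/
theorem IsOptimalPrice.exists_step_of_isOptimal (hp : M.IsOptimalPrice p) {g : ℝ → ℝ} {c : ℝ}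
    (h : M.IsOptimal p g c) :
    ∃ v, M.SolvesSystem p c v ∧ g =ᵐ[volume] M.step p v ∧ M.IsOptimal p (M.step p v) c := by
  have hp0 := hp.pos
  have hR := M.rM_pos hp0
  have hRB : M.rM p ≤ M.spreadBound := min_le_right _ _
  obtain ⟨c₀, v₀, hc₀, hP₀, hgt, hmax⟩ := hp.exists_stepProfit_max hR
  have hbind₀ := hp.binding hR hRB hc₀ hP₀ hmax
  have hge : M.stepProfit (M.rM p) c₀ v₀ ≤ M.profit p g c := by
    rw [← M.profit_step hbind₀]
    exact h.2 _ _ (M.feasible_step hp0 hbind₀)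
  obtain ⟨hc, -, h1 | ⟨v, a, ha, hv, hle, heq⟩⟩ := h.1.dichotomy hp0
  -- A constant program cannot be optimal, since the best step strictly beats p·`meanSales p`.
  · exact absurd (hp.le c) (not_le.2 (by linarith))
  have hmax' : ∀ d w, 0 ≤ d → d + M.rM p * M.beliefBelow d w ≤ p →
      M.stepProfit (M.rM p) d w ≤ M.stepProfit (M.rM p) c v := fun d w hd hw =>
    (hmax d w hd hw).trans (hge.trans hle)
  -- The cutoff and its dominating step solve the relaxed problem too; binding there forces the base
  -- reward a to vanish.
  have hbind := hp.binding hR hRB hc (by linarith) hmax'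
  have ha0 : a = 0 := by linarith
  have hprofit : M.profit p g c = M.stepProfit (M.rM p) c v :=
    le_antisymm hle ((hmax c v hc hbind.le).trans hge)
  refine ⟨v, M.solvesSystem_of_max hp0 hc hbind hmax', ?_, M.feasible_step hp0 hbind,
    fun s d hs => ?_⟩
  · filter_upwards [heq hprofit] with u hu
    rw [hu, ha0, step_eq, zero_add]
  · rw [M.profit_step hbind]
    exact hp.profit_le (hgt.trans_le (hge.trans hle)) hmax' hs

theorem IsOptimalPrice.exists_isOptimal (hp : M.IsOptimalPrice p) :
    ∃ (g : ℝ → ℝ) (c : ℝ), M.IsOptimal p g c := by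
  have hR := M.rM_pos hp.pos
  obtain ⟨c, v, hc, hP, hgt, hmax⟩ := hp.exists_stepProfit_max hR
  have hbind := hp.binding hR (min_le_right _ _) hc hP hmax
  refine ⟨M.step p v, c, M.feasible_step hp.pos hbind, fun s d hs => ?_⟩
  rw [M.profit_step hbind]
  exact hp.profit_le hgt hmax hs

lemma isSpreadProgram_salesStep (hp : 0 < p) (c v : ℝ) :
    M.IsSpreadProgram p (M.salesStep p c v) := by
  have hR := M.rM_pos hp
  have hb : ∀ a, M.salesStep p c v a ∈ Icc 0 (M.rM p) := fun a => by
    rw [salesStep]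
    by_cases h : a ∈ Iic (M.sales c v) <;> simp [h, hR.le]
  refine ⟨measurable_const.indicator measurableSet_Iic,
    fun a _ => ⟨(hb a).1, (hb a).2.trans (min_le_left _ _)⟩, fun a _ b _ => ?_⟩
  have h1 : M.rM p ≤ M.spreadBound := min_le_right _ _
  linarith [(hb a).2, (hb b).1]

lemma salesStep_sales (c v x u : ℝ) :
    M.salesStep p c v (M.sales x u) = M.step p (v - c + x) u := by
  have h : M.sales x u ∈ Iic (M.sales c v) ↔ u ∈ Iic (v - c + x) := by
    rw [mem_Iic, mem_Iic, sales, sales, strictMono_Phi.le_iff_le, div_le_div_iff_of_pos_right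
      M.σε_pos]
    constructor <;> intro h <;> linarith
  rw [salesStep, step]
  by_cases hu : u ∈ Iic (v - c + x)
  · rw [indicator_of_mem hu, indicator_of_mem (h.2 hu)]
  · rw [indicator_of_notMem hu, indicator_of_notMem fun h' => hu (h.1 h')]

/-- The equilibrium cutoff under a step in the sales volume is unique. -/
lemma isEquilibrium_salesStep_iff (hp : 0 < p) {c v : ℝ}
    (h : c + M.rM p * M.beliefBelow c v = p) (x : ℝ) :
    M.IsEquilibrium p (M.salesStep p c v) x ↔ x = c := by
  have hmono : StrictMono fun x => x + M.rM p * M.beliefBelow x (v - c + x) := by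
    refine strictMono_id.add_monotone (Monotone.const_mul (fun a b hab => ?_) (M.rM_pos hp).le)
    refine strictMono_Phi.monotone (div_le_div_of_nonneg_right ?_ M.σv_pos.le)
    have h1 := M.μ_sub_μ b a
    have h2 := mul_nonneg (sub_nonneg.2 M.τ_lt_one.le) (sub_nonneg.2 hab)
    linarith
  have hc : c + M.rM p * M.beliefBelow c (v - c + c) = p := by rwa [sub_add_cancel]
  rw [M.isEquilibrium_iff (isSpreadProgram_salesStep hp c v)]
  simp only [salesStep_sales]
  rw [expectedReward_step]
  exact ⟨fun hx => hmono.injective (hx.trans hc.symm), by rintro rfl; exact hc⟩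

lemma add_expectedReward_step_eq_iff (hp : 0 < p) {c v : ℝ}
    (h : c + M.rM p * M.beliefBelow c v = p) (x : ℝ) :
    x + M.expectedReward (M.step p v) x = p ↔ x = c := by
  have hmono := M.strictMono_add_expectedReward (M.measurable_step p v) (M.spread_step hp v)
  have hc : c + M.expectedReward (M.step p v) c = p := by rw [expectedReward_step, h]
  constructor
  · intro hx
    exact hmono.injective (hx.trans hc.symm)
  · rintro rfl
    exact hc

end Market

end RewardProgram

theorem theorem2 (M : RewardProgram.Market) (p : ℝ) (hp : M.IsOptimalPrice p) :
    -- the spread constraint guarantees monotone equilibria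
    (∀ r : ℝ → ℝ, M.IsSpreadProgram p r →
      (∀ c, StrictMono (M.payoff p r c)) ∧
      (∀ c, M.IsEquilibrium p r c ↔ c + M.expectedReward (fun v => r (M.sales c v)) c = p) ∧
      (∃ c, M.IsEquilibrium p r c)) ∧
    -- an optimal program exists
    (∃ (rhat : ℝ → ℝ) (c : ℝ), M.IsOptimal p rhat c) ∧
    -- a solution of the two equations with the highest profit among all solutions is optimal
    (∀ c vc : ℝ, M.SolvesSystem p c vc →
      (∀ d vd : ℝ, M.SolvesSystem p d vd →
        M.profit p (M.step p vd) d ≤ M.profit p (M.step p vc) c) →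
      M.IsOptimal p (M.step p vc) c) ∧
    -- every optimal program is a single step, given by the two equations
    (∀ (rhat : ℝ → ℝ) (c : ℝ), M.IsOptimal p rhat c →
      ∃ vc : ℝ,
        M.SolvesSystem p c vc ∧
        rhat =ᵐ[volume] M.step p vc ∧
        M.IsOptimal p (M.step p vc) c ∧
        -- uniqueness of the equilibrium cutoff under the optimal program
        (∀ x, M.IsEquilibrium p (M.salesStep p c vc) x ↔ x = c) ∧
        (∀ x, x + M.expectedReward (M.step p vc) x = p ↔ x = c)) := by
  refine ⟨fun r hr => ⟨M.strictMono_payoff hr, M.isEquilibrium_iff hr, M.exists_isEquilibrium hr⟩,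
    hp.exists_isOptimal, fun c vc hsys hbest => ?_, fun rhat c hopt => ?_⟩
  · obtain ⟨g, d, hg⟩ := hp.exists_isOptimal
    obtain ⟨vd, hd, -, hstep⟩ := hp.exists_step_of_isOptimal hg
    -- Some optimal step solves the system, so the best solution earns at least as much.
    exact ⟨M.feasible_step hp.pos hsys.1.symm, fun s e hs => (hstep.2 s e hs).trans (hbest d vd hd)⟩
  · obtain ⟨vc, hsys, hae, hstep⟩ := hp.exists_step_of_isOptimal hopt
    exact ⟨vc, hsys, hae, hstep, RewardProgram.Market.isEquilibrium_salesStep_iff hp.pos hsys.1.symm,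
      RewardProgram.Market.add_expectedReward_step_eq_iff hp.pos hsys.1.symm⟩
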